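/- Let $p$ be a prime, $K$ a finite extension of $\mathbb{Q}_p$ with ring of integers $o$, and $G = GL_2(\mathbb{Z}_p)$. Let $P \subseteq G$ be the subgroup of lower triangular matrices and $T \subseteq P$ the subgroup of diagonal matrices. For a profinite group $H$ put $o[[H]] = \varprojlim_N o[H/N]$, where $N$ runs over the open normal subgroups of $H$, and $K[[H]] = K \otimes_o o[[H]]$. For a continuous character $\chi : T \to o^\times$ let $K^{(\chi)}$ be the one-dimensional $K[[P]]$-module given by the composite $K[[P]] \to K[[T]] \to K$ of the map induced by the projection $P \to T$ and the continuous extension of $\chi$ to $K[[T]]$, and let $M_\chi = K[[G]] \otimes_{K[[P]]} K^{(\chi)}$. Then for any two continuous characters $\chi \neq \chi' : T \to o^\times$ one has $\operatorname{Hom}_{K[[G]]}(M_{\chi'}, M_\chi) = 0$, and $M_\chi$ and $M_{\chi'}$ are not isomorphic as $K[[G]]$-modules. In particular, those among the modules $M_\chi$ that are simple are pairwise non-isomorphic. -/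

import Mathlib

open scoped TensorProduct

noncomputable section

/-! ### Completed group algebras -/

section CompletedGroupAlgebra

variable (R : Type*) [CommRing R]

/-- The projection `R[G/H] → R[G/H']` of group algebras, for open normal subgroups `H ≤ H'`. -/
def groupAlgebraTransition {G : Type*} [Group G] [TopologicalSpace G]
    {H H' : OpenNormalSubgroup G} (h : H ≤ H') :
    MonoidAlgebra R (G ⧸ H.toSubgroup) →ₐ[R] MonoidAlgebra R (G ⧸ H'.toSubgroup) :=
  MonoidAlgebra.mapDomainAlgHom R R
    (QuotientGroup.map H.toSubgroup H'.toSubgroup (MonoidHom.id G) (fun _ hg => h hg))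

/-- The completed group algebra `R[[G]]`: the inverse limit of the group algebras `R[G/H]`, where
`H` runs over the open normal subgroups of `G`. -/
def CompletedGroupAlgebra (G : Type*) [Group G] [TopologicalSpace G] :
    Subalgebra R (∀ H : OpenNormalSubgroup G, MonoidAlgebra R (G ⧸ H.toSubgroup)) where
  carrier := {x | ∀ (H H' : OpenNormalSubgroup G) (h : H ≤ H'),
    groupAlgebraTransition R h (x H) = x H'}
  mul_mem' {x y} hx hy H H' h := by
    simp only [Pi.mul_apply, map_mul, hx H H' h, hy H H' h]
  add_mem' {x y} hx hy H H' h := by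
    simp only [Pi.add_apply, map_add, hx H H' h, hy H H' h]
  algebraMap_mem' r H H' h := by
    simp only [Pi.algebraMap_apply, AlgHom.commutes]

/-- The projection `R[[G]] → R[G/H]`. -/
def CompletedGroupAlgebra.proj {G : Type*} [Group G] [TopologicalSpace G]
    (H : OpenNormalSubgroup G) :
    CompletedGroupAlgebra R G →ₐ[R] MonoidAlgebra R (G ⧸ H.toSubgroup) :=
  (Pi.evalAlgHom R (fun H : OpenNormalSubgroup G => MonoidAlgebra R (G ⧸ H.toSubgroup)) H).comp
    (CompletedGroupAlgebra R G).val

variable {G G' : Type*} [Group G] [TopologicalSpace G] [Group G'] [TopologicalSpace G']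

/-- The preimage of an open normal subgroup under a continuous homomorphism. -/
def openNormalComap (f : G →ₜ* G') (H : OpenNormalSubgroup G') : OpenNormalSubgroup G where
  toOpenSubgroup := H.toOpenSubgroup.comap f.toMonoidHom f.continuous_toFun
  isNormal' := H.isNormal'.comap f.toMonoidHom

/-- The algebra homomorphism `R[[G]] → R[[G']]` induced by a continuous homomorphism `f : G → G'`:
its component at `H ⊆ G'` is `R[[G]] → R[G/f⁻¹(H)] → R[G'/H]`. -/
def CompletedGroupAlgebra.map (f : G →ₜ* G') :
    CompletedGroupAlgebra R G →ₐ[R] CompletedGroupAlgebra R G' :=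
  AlgHom.codRestrict
    (AlgHom.pi (R := R) (A := fun H : OpenNormalSubgroup G' => MonoidAlgebra R (G' ⧸ H.toSubgroup)) fun H =>
      (MonoidAlgebra.mapDomainAlgHom R R
        (QuotientGroup.map (openNormalComap f H).toSubgroup H.toSubgroup f.toMonoidHom
          (fun _ hg => hg))).comp (CompletedGroupAlgebra.proj R (openNormalComap f H)))
    (CompletedGroupAlgebra R G')
    (by
      intro x H H' h
      have h' : openNormalComap f H ≤ openNormalComap f H' := fun g hg => h hg
      have key := x.2 _ _ h'
      simp only [AlgHom.pi_apply, AlgHom.comp_apply]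
      change _ = MonoidAlgebra.mapDomainAlgHom R R _ (x.1 (openNormalComap f H'))
      rw [← key]
      change groupAlgebraTransition R h
        (MonoidAlgebra.mapDomainAlgHom R R _ (x.1 (openNormalComap f H))) = _
      simp only [groupAlgebraTransition, ← AlgHom.comp_apply]
      congr 1
      rw [← MonoidAlgebra.mapDomainAlgHom_comp, ← MonoidAlgebra.mapDomainAlgHom_comp]
      congr 1
      ext g
      rfl)

end CompletedGroupAlgebra

/-! ### Continuous extension of characters -/

section Character

variable {R : Type*} [CommRing R] [TopologicalSpace R] [IsTopologicalRing R] (I : Ideal R)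
  (hI : ∀ n : ℕ, IsOpen ((I ^ n : Ideal R) : Set R))
  {G : Type*} [Group G] [TopologicalSpace G] (χ : G →ₜ* Rˣ)

/-- The reduction modulo `I ^ n` of a character. -/
def characterMod (n : ℕ) : G →* (R ⧸ I ^ n)ˣ :=
  (Units.map (Ideal.Quotient.mk (I ^ n)).toMonoidHom).comp χ.toMonoidHom

theorem isOpen_characterMod_ker (hI : ∀ n : ℕ, IsOpen ((I ^ n : Ideal R) : Set R)) (n : ℕ) :
    IsOpen ((characterMod I χ n).ker : Set G) := by
  have hc : Continuous fun g => ((χ g : Rˣ) : R) :=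
    Units.continuous_val.comp χ.continuous_toFun
  refine isOpen_iff_mem_nhds.2 fun g hg => ?_
  have h1 : (fun x => ((χ x : Rˣ) : R)) ⁻¹'
      {y | Ideal.Quotient.mk (I ^ n) y = 1} = ((characterMod I χ n).ker : Set G) := by
    ext x
    simp [characterMod, MonoidHom.mem_ker, Units.ext_iff]
  rw [← h1]
  have h2 : IsOpen {y | Ideal.Quotient.mk (I ^ n) y = 1} := by
    have : {y | Ideal.Quotient.mk (I ^ n) y = 1} =
        (fun y => y - 1) ⁻¹' ((I ^ n : Ideal R) : Set R) := by
      ext y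
      simp [← Ideal.Quotient.eq_zero_iff_mem, sub_eq_zero]
    rw [this]
    exact (hI n).preimage (continuous_id.sub continuous_const)
  exact (h2.preimage hc).mem_nhds (by rw [h1]; exact hg)

/-- The kernel of the reduction of a continuous character modulo an open ideal `I ^ n`. -/
def characterModKer (n : ℕ) : OpenNormalSubgroup G where
  toSubgroup := (characterMod I χ n).ker
  isOpen' := isOpen_characterMod_ker I χ hI n
  isNormal' := MonoidHom.normal_ker _

/-- The extension of a character modulo `I ^ n` to an algebra homomorphism
`R[[G]] → R[G/ker] → R/I ^ n`. -/
def characterExtMod (n : ℕ) : CompletedGroupAlgebra R G →ₐ[R] R ⧸ I ^ n :=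
  (MonoidAlgebra.lift R (R ⧸ I ^ n) (G ⧸ (characterModKer I hI χ n).toSubgroup)
    ((Units.coeHom _).comp (QuotientGroup.kerLift (characterMod I χ n)))).comp
    (CompletedGroupAlgebra.proj R (characterModKer I hI χ n))

theorem characterExtMod_compat {m n : ℕ} (h : m ≤ n) :
    (Ideal.Quotient.factorPow I h).comp 
        (characterExtMod I hI χ n : CompletedGroupAlgebra R G →+* R ⧸ I ^ n) =
      (characterExtMod I hI χ m : CompletedGroupAlgebra R G →+* R ⧸ I ^ m) := by
  have hle : characterModKer I hI χ n ≤ characterModKer I hI χ m := by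
    intro g hg
    change g ∈ (characterMod I χ m).ker
    have hg' : g ∈ (characterMod I χ n).ker := hg
    rw [MonoidHom.mem_ker, Units.ext_iff] at hg' ⊢
    have := congrArg (Ideal.Quotient.factorPow I h) hg'
    simpa [characterMod] using this
  ext x
  have key : (Ideal.Quotient.factorₐ R (Ideal.pow_le_pow_right h)).comp
      (MonoidAlgebra.lift R (R ⧸ I ^ n) (G ⧸ (characterModKer I hI χ n).toSubgroup)
        ((Units.coeHom _).comp (QuotientGroup.kerLift (characterMod I χ n)))) =
      (MonoidAlgebra.lift R (R ⧸ I ^ m) (G ⧸ (characterModKer I hI χ m).toSubgroup)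
        ((Units.coeHom _).comp (QuotientGroup.kerLift (characterMod I χ m)))).comp
        (groupAlgebraTransition R hle) := by
    apply MonoidAlgebra.algHom_ext
    on_goal 2 => exact Subsingleton.elim _ _
    intro g
    obtain ⟨g, rfl⟩ := QuotientGroup.mk_surjective (s := (characterModKer I hI χ n).toSubgroup) g
    simp only [groupAlgebraTransition, AlgHom.comp_apply, MonoidAlgebra.mapDomainAlgHom_apply,
      MonoidAlgebra.mapDomain_single, MonoidAlgebra.lift_single, one_smul]
    rfl
  have := DFunLike.congr_fun key (x.1 (characterModKer I hI χ n))
  rw [AlgHom.comp_apply, AlgHom.comp_apply, x.2 _ _ hle] at this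
  exact this

/-- The unique continuous extension `R[[G]] → R` of a continuous character `χ : G → Rˣ`, for an
`I`-adically complete ring `R` with open ideals `I ^ n`. -/
def characterExt [IsAdicComplete I R] : CompletedGroupAlgebra R G →ₐ[R] R :=
  AlgHom.mk (IsAdicComplete.liftRingHom I
      (fun n => (characterExtMod I hI χ n : CompletedGroupAlgebra R G →+* R ⧸ I ^ n))
      (fun h => characterExtMod_compat I hI χ h)) (by
    intro r
    refine IsHausdorff.eq_iff_smodEq (I := I) |>.2 fun n => ?_
    have h := IsAdicComplete.mk_liftRingHom I
      (fun n => (characterExtMod I hI χ n : CompletedGroupAlgebra R G →+* R ⧸ I ^ n))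
      (fun h => characterExtMod_compat I hI χ h) n (algebraMap R _ r)
    rw [RingHom.coe_coe, AlgHom.commutes] at h
    rw [smul_eq_mul, Ideal.mul_top, SModEq.sub_mem]
    exact Ideal.Quotient.eq.1 h)

end Character

/-! ### Modules -/

section Modules

/-- The relations `a f(b) ⊗ v = a ⊗ b v` defining the tensor product over a (not necessarily
commutative) ring `B` inside `A ⊗_ℤ V`. -/
def balancedRelations {A B : Type*} [Ring A] [Ring B] (f : B →+* A)
    (V : Type*) [AddCommGroup V] [Module B V] : Submodule A (A ⊗[ℤ] V) :=
  Submodule.span A {z | ∃ (a : A) (b : B) (v : V), z = (a * f b) ⊗ₜ[ℤ] v - a ⊗ₜ[ℤ] (b • v)}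

/-- The left `A`-module `A ⊗_B V` obtained from a left `B`-module `V` by extension of scalars
along a homomorphism `f : B → A` of (not necessarily commutative) rings. -/
abbrev ScalarExtension {A B : Type*} [Ring A] [Ring B] (f : B →+* A)
    (V : Type*) [AddCommGroup V] [Module B V] : Type _ :=
  (A ⊗[ℤ] V) ⧸ balancedRelations f V

end Modules

/-! ### The ring of integers -/

section Integers

variable (p : ℕ) [Fact p.Prime] (K : Type*) [NormedField K] [NormedAlgebra ℚ_[p] K]

/-- The ring of integers `o` of a `p`-adic field `K`, i.e. the closed unit ball. -/
def padicIntegers : Subring K where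
  carrier := {x | ‖x‖ ≤ 1}
  mul_mem' {x y} hx hy := by
    simp only [Set.mem_ofPred_eq, norm_mul] at *
    exact mul_le_one₀ hx (norm_nonneg _) hy
  one_mem' := by simp
  add_mem' {x y} hx hy := by
    have := IsUltrametricDist.of_normedAlgebra ℚ_[p] (L := K)
    exact (IsUltrametricDist.norm_add_le_max x y).trans (max_le hx hy)
  zero_mem' := by simp
  neg_mem' {x} hx := by simpa using hx

/-- The ideal `p o`. -/
abbrev pIdeal : Ideal (padicIntegers p K) := Ideal.span {(p : padicIntegers p K)}

theorem isAdic_pIdeal : IsAdic (pIdeal p K) := by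
  have hpn : ‖(p : K)‖ = (p : ℝ)⁻¹ := by
    rw [← map_natCast (algebraMap ℚ_[p] K), norm_algebraMap', Padic.norm_p]
  have hp : (p : ℝ) ≠ 0 := mod_cast (Fact.out : p.Prime).ne_zero
  have hmem : ∀ (n : ℕ) (x : padicIntegers p K),
      x ∈ pIdeal p K ^ n ↔ ‖(x : K)‖ ≤ ((p : ℝ)⁻¹) ^ n := by
    intro n x
    have hp0 : (p : K) ≠ 0 := by
      rw [← norm_ne_zero_iff, hpn]; exact inv_ne_zero hp
    rw [pIdeal, Ideal.span_singleton_pow, Ideal.mem_span_singleton]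
    constructor
    · rintro ⟨c, rfl⟩
      have hc : ‖(c : K)‖ ≤ 1 := c.2
      push_cast
      rw [norm_mul, norm_pow, hpn]
      exact mul_le_of_le_one_right (by positivity) hc
    · intro hx
      refine ⟨⟨(x : K) / (p : K) ^ n, ?_⟩, ?_⟩
      · change ‖(x : K) / (p : K) ^ n‖ ≤ 1
        rw [norm_div, norm_pow, hpn]
        exact div_le_one_of_le₀ hx (by positivity)
      · ext
        push_cast
        rw [mul_div_cancel₀ _ (pow_ne_zero n hp0)]
  have hlt : (p : ℝ)⁻¹ < 1 := inv_lt_one_of_one_lt₀ (mod_cast (Fact.out : p.Prime).one_lt)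
  have hpos : 0 < (p : ℝ)⁻¹ := inv_pos.2 (mod_cast (Fact.out : p.Prime).pos)
  rw [isAdic_iff]
  constructor
  · intro n
    refine AddSubgroup.isOpen_of_mem_nhds (Submodule.toAddSubgroup (pIdeal p K ^ n)) (g := 0) ?_
    refine Metric.mem_nhds_iff.2 ⟨((p : ℝ)⁻¹) ^ n, pow_pos hpos n, fun x hx => ?_⟩
    refine (hmem n x).2 ?_
    rw [Metric.mem_ball, Subtype.dist_eq] at hx
    simpa using hx.le
  · intro s hs
    obtain ⟨ε, hε, hs⟩ := Metric.mem_nhds_iff.1 hs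
    obtain ⟨n, hn⟩ := exists_pow_lt_of_lt_one hε hlt
    refine ⟨n, fun x hx => hs ?_⟩
    rw [Metric.mem_ball, Subtype.dist_eq]
    simpa using ((hmem n x).1 hx).trans_lt hn

instance [FiniteDimensional ℚ_[p] K] : IsAdicComplete (pIdeal p K) (padicIntegers p K) := by
  have : CompleteSpace K := FiniteDimensional.complete ℚ_[p] K
  have hcl : IsClosed ((padicIntegers p K : Subring K) : Set K) :=
    isClosed_le continuous_norm continuous_const
  have : CompleteSpace (padicIntegers p K) := hcl.completeSpace_coe
  exact (isAdic_pIdeal p K).isAdicComplete_iff.2 ⟨this, inferInstance⟩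

/-- The Iwasawa algebra `K[[G]] = K ⊗_o o[[G]]`. -/
abbrev IwasawaAlgebra (G : Type*) [Group G] [TopologicalSpace G] : Type _ :=
  K ⊗[padicIntegers p K] CompletedGroupAlgebra (padicIntegers p K) G

/-- Functoriality of `K[[G]]` in the group. -/
def IwasawaAlgebra.map {G G' : Type*} [Group G] [TopologicalSpace G] [Group G']
    [TopologicalSpace G'] (f : G →ₜ* G') : IwasawaAlgebra p K G →ₐ[K] IwasawaAlgebra p K G' :=
  Algebra.TensorProduct.map (AlgHom.id K K) (CompletedGroupAlgebra.map (padicIntegers p K) f)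

variable {p K}

/-- The continuous extension `K[[G]] → K` of a continuous character `χ : G → oˣ`. -/
def IwasawaAlgebra.character [FiniteDimensional ℚ_[p] K] {G : Type*} [Group G]
    [TopologicalSpace G] (χ : G →ₜ* (padicIntegers p K)ˣ) : IwasawaAlgebra p K G →ₐ[K] K :=
  Algebra.TensorProduct.lift (AlgHom.id K K)
    ((Algebra.ofId (padicIntegers p K) K).comp
      (characterExt (pIdeal p K) (fun n => (isAdic_iff.mp (isAdic_pIdeal p K)).1 n) χ))
    (fun _ _ => Commute.all _ _)

end Integers

/-! ### The group `GL₂(ℤ_p)` -/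

section GL2

variable (p : ℕ) [Fact p.Prime]

/-- The group `P` of lower triangular matrices in `GL₂(ℤ_p)`. -/
def lowerTriangular : Subgroup (GL (Fin 2) ℤ_[p]) where
  carrier := {g | g 0 1 = 0}
  mul_mem' {a b} ha hb := by
    simp only [Set.mem_ofPred_eq] at *
    simp [Matrix.mul_apply, ha, hb]
  one_mem' := by simp
  inv_mem' {a} ha := by
    simp only [Set.mem_ofPred_eq] at *
    simp [Matrix.inv_def, Matrix.adjugate_fin_two, ha]

/-- The group `T` of diagonal matrices in `GL₂(ℤ_p)`. -/
def diagonalTorus : Subgroup (GL (Fin 2) ℤ_[p]) where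
  carrier := {g | g 0 1 = 0 ∧ g 1 0 = 0}
  mul_mem' {a b} ha hb := by
    simp only [Set.mem_ofPred_eq] at *
    simp [Matrix.mul_apply, ha, hb]
  one_mem' := by simp
  inv_mem' {a} ha := by
    simp only [Set.mem_ofPred_eq] at *
    simp [Matrix.inv_def, Matrix.adjugate_fin_two, ha]

/-- The inclusion `P → GL₂(ℤ_p)`. -/
def lowerTriangularInclusion : lowerTriangular p →ₜ* GL (Fin 2) ℤ_[p] where
  toMonoidHom := (lowerTriangular p).subtype
  continuous_toFun := continuous_subtype_val

theorem lowerTriangular_apply_mul (a b : lowerTriangular p) (i : Fin 2) :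
    (a * b).1 i i = a.1 i i * b.1 i i := by
  have ha : a.1 0 1 = 0 := a.2
  have hb : b.1 0 1 = 0 := b.2
  fin_cases i <;> simp [Matrix.mul_apply, ha, hb]

theorem lowerTriangular_apply_mul_inv (a : lowerTriangular p) (i : Fin 2) :
    a.1 i i * (a⁻¹).1 i i = 1 := by
  rw [← lowerTriangular_apply_mul, mul_inv_cancel]
  simp

/-- The projection `P → T` onto the diagonal part. -/
def torusProjection : lowerTriangular p →ₜ* diagonalTorus p where
  toFun g := ⟨⟨!![g.1 0 0, 0; 0, g.1 1 1], !![(g⁻¹).1 0 0, 0; 0, (g⁻¹).1 1 1],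
    by
      have h0 := lowerTriangular_apply_mul_inv p g 0
      have h1 := lowerTriangular_apply_mul_inv p g 1
      ext i j; fin_cases i <;> fin_cases j <;> simp_all [Matrix.mul_apply],
    by
      have h0 := lowerTriangular_apply_mul_inv p g 0
      have h1 := lowerTriangular_apply_mul_inv p g 1
      rw [mul_comm] at h0 h1
      ext i j; fin_cases i <;> fin_cases j <;> simp_all [Matrix.mul_apply]⟩,
    by constructor <;> rfl⟩
  map_one' := by
    ext i j; fin_cases i <;> fin_cases j <;> simp
  map_mul' a b := by
    ext i j
    have h0 := lowerTriangular_apply_mul p a b 0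
    have h1 := lowerTriangular_apply_mul p a b 1
    fin_cases i <;> fin_cases j <;> simp_all [Matrix.mul_apply]
  continuous_toFun := by
    refine Continuous.subtype_mk (Units.continuous_iff.2 ⟨?_, ?_⟩) _
    · refine continuous_matrix fun i j => ?_
      have h : ∀ k : Fin 2, Continuous fun g : lowerTriangular p => g.1 k k := fun k =>
        (Units.continuous_val.comp continuous_subtype_val).matrix_elem k k
      fin_cases i <;> fin_cases j <;> simp [h, continuous_const]
    · refine continuous_matrix fun i j => ?_
      have h : ∀ k : Fin 2, Continuous fun g : lowerTriangular p => (g⁻¹).1 k k := fun k =>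
        (Units.continuous_val.comp (continuous_subtype_val.comp continuous_inv)).matrix_elem k k
      fin_cases i <;> fin_cases j
      exacts [h 0, continuous_const, continuous_const, h 1]

variable {p} {K : Type*} [NormedField K] [NormedAlgebra ℚ_[p] K] [FiniteDimensional ℚ_[p] K]

/-- The one-dimensional `K[[P]]`-module `K^(χ)`: the space `K` on which `K[[P]]` acts through
`K[[P]] → K[[T]] → K`. -/
def TorusCharModule (_χ : diagonalTorus p →ₜ* (padicIntegers p K)ˣ) : Type _ := K

instance (χ : diagonalTorus p →ₜ* (padicIntegers p K)ˣ) : AddCommGroup (TorusCharModule χ) :=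
  inferInstanceAs (AddCommGroup K)

instance (χ : diagonalTorus p →ₜ* (padicIntegers p K)ˣ) :
    Module (IwasawaAlgebra p K (lowerTriangular p)) (TorusCharModule χ) :=
  Module.compHom K (((IwasawaAlgebra.character χ).comp
    (IwasawaAlgebra.map p K (torusProjection p))).toRingHom)

/-- The induced module `M_χ = K[[G]] ⊗_{K[[P]]} K^(χ)`, for `G = GL₂(ℤ_p)`. -/
abbrev PrincipalSeriesModule (χ : diagonalTorus p →ₜ* (padicIntegers p K)ˣ) : Type _ :=
  ScalarExtension
    (IwasawaAlgebra.map p K (lowerTriangularInclusion p) :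
      IwasawaAlgebra p K (lowerTriangular p) →+* IwasawaAlgebra p K (GL (Fin 2) ℤ_[p]))
    (TorusCharModule χ)

end GL2

end

/-! An element of `o[[G]]` is an `o`-valued measure on `G`, and a continuous function `φ` with `φ (x
* b) = φ x * χ b` for `b ∈ P` gives a functional on `K[[G]]` that kills the annihilator of the
generator `e = 1 ⊗ 1` of `M_χ`. Let `f : M_χ' → M_χ` and `f e' = α • e`. Up to a scalar of `K`, `α`
is a measure `a`. The lower unipotent group `N` lies in the kernel of `P → T`, so it fixes `e'`, and
the integrals of equivariant functions against `a` are `N`-invariant.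

The second column identifies `G/P` with the projective line over `ℤ_p`. There `N` fixes only the
base point `P`; every other orbit is open, and `N` acts freely on it, so it is a copy of `ℤ_p`. A
bounded translation-invariant measure on `ℤ_p` is zero: a ball is the disjoint union of `p ^ r`
translates of a smaller one, so its mass is divisible by every power of `p`
(`integral_orbitFun_eq_zero`).

Hence `a` is concentrated on `P`. It has to be shown that then `a` is a scalar modulo the left ideal
generated by the elements `[b] - χ(b)` (`mem_scalarsSupLeftSpan_of_integral_eq_zero`). This is a
limit of computations at finite levels, and needs the ideal to be closed. That holds because `P` is
topologically finitely generated: finitely many `[b] - χ(b)` generate the ideal, which is thus a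
continuous image of a compact space.

So `f e' = c • e` with `c ∈ K`. If `χ t ≠ χ' t`, then `t` acts on this vector by two different
scalars, so it vanishes and `f = 0`. Since `e ≠ 0`, as an equivariant test function shows, there is
no isomorphism either. -/

noncomputable section

/-! ### Integration of continuous functions against elements of a completed group algebra -/

section GroupElements

variable (R : Type*) [CommRing R] {G : Type*} [Group G] [TopologicalSpace G]

/-- The canonical map from `G` to `R[[G]]`. -/
def CompletedGroupAlgebra.of : G →* CompletedGroupAlgebra R G where
  toFun g := ⟨fun H => MonoidAlgebra.single (g : G ⧸ H.toSubgroup) 1, by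
    intro H H' h
    rw [groupAlgebraTransition, MonoidAlgebra.mapDomainAlgHom_apply, MonoidAlgebra.mapDomain_single]
    rfl⟩
  map_one' := by
    ext1; funext H; rfl
  map_mul' a b := by
    ext1; funext H
    change _ = MonoidAlgebra.single (a : G ⧸ H.toSubgroup) (1 : R) *
      MonoidAlgebra.single (b : G ⧸ H.toSubgroup) 1
    simp [MonoidAlgebra.single_mul_single]

theorem CompletedGroupAlgebra.proj_of (H : OpenNormalSubgroup G) (g : G) :
    CompletedGroupAlgebra.proj R H (CompletedGroupAlgebra.of R g) =
      MonoidAlgebra.single (g : G ⧸ H.toSubgroup) 1 := rfl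

theorem CompletedGroupAlgebra.transition_proj {H H' : OpenNormalSubgroup G} (h : H ≤ H')
    (a : CompletedGroupAlgebra R G) :
    groupAlgebraTransition R h (CompletedGroupAlgebra.proj R H a) =
      CompletedGroupAlgebra.proj R H' a := a.2 H H' h

theorem groupAlgebraTransition_single {H H' : OpenNormalSubgroup G} (h : H ≤ H') (g : G) (r : R) :
    groupAlgebraTransition R h (MonoidAlgebra.single (g : G ⧸ H.toSubgroup) r) =
      MonoidAlgebra.single (g : G ⧸ H'.toSubgroup) r := by
  rw [groupAlgebraTransition, MonoidAlgebra.mapDomainAlgHom_apply, MonoidAlgebra.mapDomain_single]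
  rfl

theorem CompletedGroupAlgebra.map_of {G' : Type*} [Group G'] [TopologicalSpace G']
    (f : G →ₜ* G') (g : G) :
    CompletedGroupAlgebra.map R f (CompletedGroupAlgebra.of R g) =
      CompletedGroupAlgebra.of R (f g) := by
  ext1; funext H
  change MonoidAlgebra.mapDomainAlgHom R R _ (MonoidAlgebra.single _ _) = MonoidAlgebra.single _ _
  rw [MonoidAlgebra.mapDomainAlgHom_apply, MonoidAlgebra.mapDomain_single]
  rfl

theorem exists_le_forall_le {ι : Type*} (H : ι → OpenNormalSubgroup G) (H₀ : OpenNormalSubgroup G)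
    (s : Finset ι) : ∃ H' ≤ H₀, ∀ i ∈ s, H' ≤ H i := by
  classical
  induction s using Finset.induction_on with
  | empty => exact ⟨H₀, le_rfl, by simp⟩
  | insert i s hi ih =>
    obtain ⟨H', h1, h2⟩ := ih
    refine ⟨H' ⊓ H i, inf_le_left.trans h1, fun j hj => ?_⟩
    obtain rfl | hj := Finset.mem_insert.1 hj
    · exact inf_le_right
    · exact inf_le_left.trans (h2 j hj)

variable {R}

theorem MonoidAlgebra.induction_mk {H : OpenNormalSubgroup G}
    {motive : MonoidAlgebra R (G ⧸ H.toSubgroup) → Prop}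
    (x : MonoidAlgebra R (G ⧸ H.toSubgroup)) (zero : motive 0)
    (add : ∀ x y, motive x → motive y → motive (x + y))
    (single : ∀ (g : G) (r : R), motive (MonoidAlgebra.single (g : G ⧸ H.toSubgroup) r)) :
    motive x := by
  refine MonoidAlgebra.induction_linear x zero (fun _ _ hx hy => add _ _ hx hy) fun q r => ?_
  obtain ⟨g, rfl⟩ := QuotientGroup.mk_surjective q
  exact single g r

/-- The Riemann sum of a function on `G` with respect to an element of `R[G/H]`. -/
def levelSum (φ : G → R) (H : OpenNormalSubgroup G) :
    MonoidAlgebra R (G ⧸ H.toSubgroup) →ₗ[R] R :=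
  (Finsupp.linearCombination R fun q : G ⧸ H.toSubgroup => φ q.out) ∘ₗ
    (MonoidAlgebra.coeffLinearEquiv R).toLinearMap

theorem levelSum_single (φ : G → R) (H : OpenNormalSubgroup G) (q : G ⧸ H.toSubgroup) (r : R) :
    levelSum φ H (MonoidAlgebra.single q r) = r * φ q.out := by
  change Finsupp.linearCombination R _ (Finsupp.single q r) = _
  simp

/-- The function `φ` is invariant modulo `J` under right translation by `H`. -/
def IsLevel (J : Ideal R) (φ : G → R) (H : OpenNormalSubgroup G) : Prop :=
  ∀ g, ∀ h ∈ H, φ (g * h) - φ g ∈ J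

theorem IsLevel.mono {J : Ideal R} {φ : G → R} {H H' : OpenNormalSubgroup G}
    (hφ : IsLevel J φ H') (h : H ≤ H') : IsLevel J φ H := fun g x hx => hφ g x (h hx)

theorem IsLevel.mono_ideal {J J' : Ideal R} {φ : G → R} {H : OpenNormalSubgroup G}
    (hφ : IsLevel J φ H) (h : J ≤ J') : IsLevel J' φ H := fun g x hx => h (hφ g x hx)

theorem IsLevel.out_sub_mem {J : Ideal R} {φ : G → R} {H : OpenNormalSubgroup G}
    (hφ : IsLevel J φ H) (g : G) : φ ((g : G ⧸ H.toSubgroup).out) - φ g ∈ J := by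
  obtain ⟨h, hh⟩ := QuotientGroup.mk_out_eq_mul H.toSubgroup g
  rw [hh]
  exact hφ g h h.2

theorem IsLevel.levelSum_mk_sub_mem {J : Ideal R} {φ : G → R} {H : OpenNormalSubgroup G}
    (hφ : IsLevel J φ H) (g : G) (r : R) :
    levelSum φ H (MonoidAlgebra.single (g : G ⧸ H.toSubgroup) r) - r * φ g ∈ J := by
  rw [levelSum_single, ← mul_sub]
  exact J.mul_mem_left _ (hφ.out_sub_mem g)

theorem IsLevel.levelSum_transition {J : Ideal R} {φ : G → R} {H H' : OpenNormalSubgroup G}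
    (hφ : IsLevel J φ H') (h : H ≤ H') (x : MonoidAlgebra R (G ⧸ H.toSubgroup)) :
    levelSum φ H x - levelSum φ H' (groupAlgebraTransition R h x) ∈ J := by
  induction x using MonoidAlgebra.induction_mk with
  | zero => simp
  | add x y hx hy =>
    rw [map_add, map_add, map_add, add_sub_add_comm]
    exact J.add_mem hx hy
  | single g r =>
    rw [groupAlgebraTransition_single]
    have := J.sub_mem ((hφ.mono h).levelSum_mk_sub_mem g r) (hφ.levelSum_mk_sub_mem g r)
    simpa using this

/-- Both Riemann sums are compared with the one at the common refinement `H ⊓ H'`. -/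
theorem IsLevel.levelSum_proj_sub {J : Ideal R} {φ : G → R} {H H' : OpenNormalSubgroup G}
    (hφ : IsLevel J φ H) (hφ' : IsLevel J φ H') (a : CompletedGroupAlgebra R G) :
    levelSum φ H (CompletedGroupAlgebra.proj R H a) -
      levelSum φ H' (CompletedGroupAlgebra.proj R H' a) ∈ J := by
  have h1 := hφ.levelSum_transition (inf_le_left : H ⊓ H' ≤ H)
    (CompletedGroupAlgebra.proj R _ a)
  have h2 := hφ'.levelSum_transition (inf_le_right : H ⊓ H' ≤ H')
    (CompletedGroupAlgebra.proj R _ a)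
  rw [CompletedGroupAlgebra.transition_proj] at h1 h2
  simpa using J.sub_mem h2 h1

theorem levelSum_sum {ι : Type*} (s : Finset ι) (φ : ι → G → R) (H : OpenNormalSubgroup G)
    (x : MonoidAlgebra R (G ⧸ H.toSubgroup)) :
    levelSum (fun g => ∑ i ∈ s, φ i g) H x = ∑ i ∈ s, levelSum (φ i) H x := by
  induction x using MonoidAlgebra.induction_mk with
  | zero => simp
  | add x y hx hy => simp only [map_add, hx, hy, Finset.sum_add_distrib]
  | single g r => simp only [levelSum_single, Finset.mul_sum]

theorem proj_map_single {G' : Type*} [Group G'] [TopologicalSpace G']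
    (f : G' →ₜ* G) (H : OpenNormalSubgroup G) (g : G') (r : R) :
    MonoidAlgebra.mapDomainAlgHom R R
        (QuotientGroup.map (openNormalComap f H).toSubgroup H.toSubgroup f.toMonoidHom
          (fun _ hg => hg)) (MonoidAlgebra.single (g : G' ⧸ (openNormalComap f H).toSubgroup) r) =
      MonoidAlgebra.single (f g : G ⧸ H.toSubgroup) r := by
  rw [MonoidAlgebra.mapDomainAlgHom_apply, MonoidAlgebra.mapDomain_single]
  rfl

theorem proj_map {G' : Type*} [Group G'] [TopologicalSpace G']
    (f : G' →ₜ* G) (H : OpenNormalSubgroup G) (a : CompletedGroupAlgebra R G') :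
    CompletedGroupAlgebra.proj R H (CompletedGroupAlgebra.map R f a) =
      MonoidAlgebra.mapDomainAlgHom R R
        (QuotientGroup.map (openNormalComap f H).toSubgroup H.toSubgroup f.toMonoidHom
          (fun _ hg => hg)) (CompletedGroupAlgebra.proj R (openNormalComap f H) a) := rfl

end GroupElements

/-! ### Integrals as `I`-adic limits of Riemann sums -/

section Integral

variable {R : Type*} [CommRing R] [TopologicalSpace R] [IsTopologicalRing R]
  {G : Type*} [Group G] [TopologicalSpace G] [IsTopologicalGroup G] [CompactSpace G]
  [TotallyDisconnectedSpace G]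

/-- Uniform continuity on a compact group; in a profinite group the resulting neighbourhood of `1`
contains an open normal subgroup. -/
theorem exists_isLevel {J : Ideal R} (hJ : IsOpen (J : Set R)) (φ : C(G, R)) :
    ∃ H : OpenNormalSubgroup G, IsLevel J φ H := by
  have h : ∀ᶠ x in nhds (1 : G), ∀ g ∈ (Set.univ : Set G), φ (g * x) - φ g ∈ J := by
    refine isCompact_univ.eventually_forall_of_forall_eventually fun g _ => ?_
    have hc : Continuous fun z : G × G => φ (z.2 * z.1) - φ z.2 := by fun_prop
    exact (hJ.preimage hc).mem_nhds (by simp)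
  obtain ⟨W, hW, hWo, hW1⟩ := mem_nhds_iff.1 h
  obtain ⟨H, hH⟩ := ProfiniteGrp.exist_openNormalSubgroup_sub_open_nhds_of_one hWo hW1
  exact ⟨H, fun g x hx => hW (hH hx) g trivial⟩

variable (I : Ideal R) (hI : ∀ n : ℕ, IsOpen ((I ^ n : Ideal R) : Set R)) [IsAdicComplete I R]

omit [TopologicalSpace R] [IsTopologicalRing R] in
theorem eq_of_forall_sub_mem_pow {x y : R} (h : ∀ n, x - y ∈ I ^ n) : x = y := by
  refine (IsHausdorff.eq_iff_smodEq (I := I)).2 fun n => ?_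
  rw [smul_eq_mul, Ideal.mul_top, SModEq.sub_mem]
  exact h n

/-- The integral of a continuous function `φ : G → R`, as a linear form on `R[[G]]`. -/
def integral (φ : C(G, R)) : CompletedGroupAlgebra R G →ₗ[R] R :=
  IsAdicComplete.lift I
    (fun n => Submodule.mkQ (I ^ n • ⊤ : Submodule R R) ∘ₗ
      levelSum φ (exists_isLevel (hI n) φ).choose ∘ₗ
      (CompletedGroupAlgebra.proj R (exists_isLevel (hI n) φ).choose).toLinearMap) (by
    intro m n hmn
    ext a
    refine (Submodule.Quotient.eq _).2 ?_
    rw [smul_eq_mul, Ideal.mul_top]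
    exact ((exists_isLevel (hI n) φ).choose_spec.mono_ideal
      (Ideal.pow_le_pow_right hmn)).levelSum_proj_sub (exists_isLevel (hI m) φ).choose_spec a)

/-- Frees the integral from the levels chosen in its definition. Later identities between integrals
are checked modulo each `I ^ n` at a convenient level. -/
theorem IsLevel.integral_sub_mem {φ : C(G, R)} {n : ℕ} {H : OpenNormalSubgroup G}
    (hφ : IsLevel (I ^ n) φ H) (a : CompletedGroupAlgebra R G) :
    integral I hI φ a - levelSum φ H (CompletedGroupAlgebra.proj R H a) ∈ I ^ n := by
  have h := IsAdicComplete.mk_lift I (f := fun n => Submodule.mkQ (I ^ n • ⊤ : Submodule R R) ∘ₗ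
      levelSum φ (exists_isLevel (hI n) φ).choose ∘ₗ
      (CompletedGroupAlgebra.proj R (exists_isLevel (hI n) φ).choose).toLinearMap) (by
    intro m n hmn
    ext a
    refine (Submodule.Quotient.eq _).2 ?_
    rw [smul_eq_mul, Ideal.mul_top]
    exact ((exists_isLevel (hI n) φ).choose_spec.mono_ideal
      (Ideal.pow_le_pow_right hmn)).levelSum_proj_sub (exists_isLevel (hI m) φ).choose_spec a) n a
  have h' := (Submodule.Quotient.eq _).1 h
  rw [smul_eq_mul, Ideal.mul_top] at h'
  have h2 := (I ^ n).add_mem h' ((exists_isLevel (hI n) φ).choose_spec.levelSum_proj_sub hφ a)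
  rw [LinearMap.comp_apply, AlgHom.toLinearMap_apply, sub_add_sub_cancel] at h2
  exact h2

theorem integral_of (φ : C(G, R)) (g : G) :
    integral I hI φ (CompletedGroupAlgebra.of R g) = φ g := by
  refine eq_of_forall_sub_mem_pow I fun n => ?_
  obtain ⟨H, hH⟩ := exists_isLevel (hI n) φ
  have h1 := hH.integral_sub_mem I hI (CompletedGroupAlgebra.of R g)
  rw [CompletedGroupAlgebra.proj_of] at h1
  simpa using (I ^ n).add_mem h1 (hH.levelSum_mk_sub_mem g 1)

theorem integral_sum {ι : Type*} (s : Finset ι) (φ : ι → C(G, R)) (ψ : C(G, R))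
    (h : ∀ g, ψ g = ∑ i ∈ s, φ i g) (a : CompletedGroupAlgebra R G) :
    integral I hI ψ a = ∑ i ∈ s, integral I hI (φ i) a := by
  refine eq_of_forall_sub_mem_pow I fun n => ?_
  choose H hH using fun i => exists_isLevel (hI n) (φ i)
  obtain ⟨H₀, hH₀⟩ := exists_isLevel (hI n) ψ
  obtain ⟨H', h1, h2⟩ := exists_le_forall_le H H₀ s
  have e : levelSum ψ H' (CompletedGroupAlgebra.proj R H' a) =
      ∑ i ∈ s, levelSum (φ i) H' (CompletedGroupAlgebra.proj R H' a) := by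
    rw [← levelSum_sum]
    congr 1
    exact congrArg (fun f => levelSum f H') (funext h)
  have h3 := (hH₀.mono h1).integral_sub_mem I hI a
  have h4 : ∑ i ∈ s, integral I hI (φ i) a -
      ∑ i ∈ s, levelSum (φ i) H' (CompletedGroupAlgebra.proj R H' a) ∈ I ^ n := by
    rw [← Finset.sum_sub_distrib]
    exact (I ^ n).sum_mem fun i hi => ((hH i).mono (h2 i hi)).integral_sub_mem I hI a
  rw [← e] at h4
  simpa using (I ^ n).sub_mem h3 h4

/-- Left translation of a continuous function. -/
def leftTranslate (g : G) (φ : C(G, R)) : C(G, R) := φ.comp ⟨fun x => g * x, by fun_prop⟩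

/-- Levels concern right translation, so a level for `φ` is also one for its left translates. -/
theorem integral_of_mul (φ : C(G, R)) (g : G) (a : CompletedGroupAlgebra R G) :
    integral I hI φ (CompletedGroupAlgebra.of R g * a) = integral I hI (leftTranslate g φ) a := by
  refine eq_of_forall_sub_mem_pow I fun n => ?_
  obtain ⟨H, hH⟩ := exists_isLevel (hI n) φ
  have hH' : IsLevel (I ^ n) (leftTranslate g φ) H := by
    intro x h hh
    simpa [leftTranslate, mul_assoc] using hH (g * x) h hh
  have h1 := hH.integral_sub_mem I hI (CompletedGroupAlgebra.of R g * a)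
  have h2 := hH'.integral_sub_mem I hI a
  have key : ∀ x : MonoidAlgebra R (G ⧸ H.toSubgroup),
      levelSum φ H (MonoidAlgebra.single (g : G ⧸ H.toSubgroup) 1 * x) -
        levelSum (leftTranslate g φ) H x ∈ I ^ n := by
    intro x
    induction x using MonoidAlgebra.induction_mk with
    | zero => simp
    | add x y hx hy =>
      rw [mul_add, map_add, map_add, add_sub_add_comm]
      exact (I ^ n).add_mem hx hy
    | single y r =>
      rw [MonoidAlgebra.single_mul_single, one_mul, ← QuotientGroup.mk_mul]
      have := (I ^ n).sub_mem (hH.levelSum_mk_sub_mem (g * y) r) (hH'.levelSum_mk_sub_mem y r)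
      simpa [leftTranslate] using this
  rw [map_mul (CompletedGroupAlgebra.proj R H), CompletedGroupAlgebra.proj_of] at h1
  have := (I ^ n).add_mem h1 ((I ^ n).sub_mem (key (CompletedGroupAlgebra.proj R H a)) h2)
  convert this using 1
  ring

variable {G' : Type*} [Group G'] [TopologicalSpace G'] [IsTopologicalGroup G'] [CompactSpace G']
  [TotallyDisconnectedSpace G']

theorem integral_map (f : G' →ₜ* G) (φ : C(G, R)) (a : CompletedGroupAlgebra R G') :
    integral I hI φ (CompletedGroupAlgebra.map R f a) =
      integral I hI (φ.comp (f : C(G', G))) a := by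
  refine eq_of_forall_sub_mem_pow I fun n => ?_
  obtain ⟨H, hH⟩ := exists_isLevel (hI n) φ
  have hH' : IsLevel (I ^ n) (φ.comp (f : C(G', G))) (openNormalComap f H) := by
    intro x h hh
    simpa using hH (f x) (f h) hh
  have h1 := hH.integral_sub_mem I hI (CompletedGroupAlgebra.map R f a)
  have h2 := hH'.integral_sub_mem I hI a
  rw [proj_map] at h1
  have key : ∀ x : MonoidAlgebra R (G' ⧸ (openNormalComap f H).toSubgroup),
      levelSum φ H (MonoidAlgebra.mapDomainAlgHom R R
        (QuotientGroup.map (openNormalComap f H).toSubgroup H.toSubgroup f.toMonoidHom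
          (fun _ hg => hg)) x) -
        levelSum (φ.comp (f : C(G', G))) (openNormalComap f H) x ∈ I ^ n := by
    intro x
    induction x using MonoidAlgebra.induction_mk with
    | zero => simp
    | add x y hx hy =>
      rw [map_add, map_add, map_add, add_sub_add_comm]
      exact (I ^ n).add_mem hx hy
    | single y r =>
      rw [proj_map_single]
      have := (I ^ n).sub_mem (hH.levelSum_mk_sub_mem (f y) r) (hH'.levelSum_mk_sub_mem y r)
      simpa using this
  have := (I ^ n).add_mem h1 ((I ^ n).sub_mem (key (CompletedGroupAlgebra.proj R _ a)) h2)
  convert this using 1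
  ring

/-- A continuous character, as a continuous function. -/
def characterFun (ψ : G' →ₜ* Rˣ) : C(G', R) :=
  ⟨fun g => (ψ g : R), Units.continuous_val.comp ψ.continuous_toFun⟩

/-- The kernel of `ψ` modulo `I ^ n` is a level for `ψ`, and there both sides are the same finite
sum. -/
theorem characterExt_eq_integral (ψ : G' →ₜ* Rˣ) (a : CompletedGroupAlgebra R G') :
    characterExt I hI ψ a = integral I hI (characterFun ψ) a := by
  refine eq_of_forall_sub_mem_pow I fun n => ?_
  have h := IsAdicComplete.mk_liftRingHom I
      (fun n => (characterExtMod I hI ψ n : CompletedGroupAlgebra R G' →+* R ⧸ I ^ n))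
      (fun h => characterExtMod_compat I hI ψ h) n a
  have hH : IsLevel (I ^ n) (characterFun ψ) (characterModKer I hI ψ n) := by
    intro x h hh
    have hh' : characterMod I ψ n h = 1 := hh
    have hh'' : Ideal.Quotient.mk (I ^ n) (ψ h : R) = 1 := congrArg Units.val hh'
    rw [← Ideal.Quotient.eq]
    simp [characterFun, hh'']
  have h2 := hH.integral_sub_mem I hI a
  have key : ∀ x : MonoidAlgebra R (G' ⧸ (characterModKer I hI ψ n).toSubgroup),
      MonoidAlgebra.lift R (R ⧸ I ^ n) (G' ⧸ (characterModKer I hI ψ n).toSubgroup)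
        ((Units.coeHom _).comp (QuotientGroup.kerLift (characterMod I ψ n))) x =
      Ideal.Quotient.mk (I ^ n) (levelSum (characterFun ψ) _ x) := by
    intro x
    induction x using MonoidAlgebra.induction_mk with
    | zero => simp
    | add x y hx hy => simp only [map_add, hx, hy]
    | single y r =>
      rw [Ideal.Quotient.eq.2 (hH.levelSum_mk_sub_mem y r), MonoidAlgebra.lift_single, map_mul,
        Algebra.smul_def]
      rfl
  rw [← Ideal.Quotient.eq] at h2 ⊢
  rw [h2, ← key]
  exact h

/-- This makes integration of an equivariant function compatible with the relations of the induced
module. -/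
theorem integral_mul_map (f : G' →ₜ* G) (ψ : G' →ₜ* Rˣ) (φ : C(G, R))
    (hφ : ∀ g b, φ (g * f b) = φ g * ψ b) (a : CompletedGroupAlgebra R G)
    (β : CompletedGroupAlgebra R G') :
    integral I hI φ (a * CompletedGroupAlgebra.map R f β) =
      integral I hI φ a * integral I hI (characterFun ψ) β := by
  refine eq_of_forall_sub_mem_pow I fun n => ?_
  obtain ⟨H, hH⟩ := exists_isLevel (hI n) φ
  obtain ⟨L, hL⟩ := exists_isLevel (hI n) (characterFun ψ)
  -- Small enough both to map to `G/H` and to be a level for `ψ`.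
  set Q := openNormalComap f H ⊓ L
  have hL' : IsLevel (I ^ n) (characterFun ψ) Q := hL.mono inf_le_right
  have hQ : Q ≤ openNormalComap f H := inf_le_left
  have h1 := hH.integral_sub_mem I hI (a * CompletedGroupAlgebra.map R f β)
  have h2 := hH.integral_sub_mem I hI a
  have h3 := hL'.integral_sub_mem I hI β
  rw [map_mul (CompletedGroupAlgebra.proj R H), proj_map, ← CompletedGroupAlgebra.transition_proj R hQ] at h1
  have key : ∀ (x : MonoidAlgebra R (G ⧸ H.toSubgroup)) (y : MonoidAlgebra R (G' ⧸ Q.toSubgroup)),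
      levelSum φ H (x * MonoidAlgebra.mapDomainAlgHom R R
        (QuotientGroup.map (openNormalComap f H).toSubgroup H.toSubgroup f.toMonoidHom
          (fun _ hg => hg)) (groupAlgebraTransition R hQ y)) -
        levelSum φ H x * levelSum (characterFun ψ) Q y ∈ I ^ n := by
    intro x y
    induction x using MonoidAlgebra.induction_mk with
    | zero => simp
    | add x x' hx hx' =>
      rw [add_mul, map_add, map_add, add_mul, add_sub_add_comm]
      exact (I ^ n).add_mem hx hx'
    | single g r =>
      induction y using MonoidAlgebra.induction_mk with
      | zero => simp
      | add y y' hy hy' =>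
        rw [map_add, map_add, mul_add, map_add, map_add, mul_add, add_sub_add_comm]
        exact (I ^ n).add_mem hy hy'
      | single b s =>
        rw [groupAlgebraTransition_single, proj_map_single, MonoidAlgebra.single_mul_single,
          ← QuotientGroup.mk_mul]
        have e1 := Ideal.Quotient.eq.2 (hH.levelSum_mk_sub_mem (g * f b) (r * s))
        have e2 := Ideal.Quotient.eq.2 (hH.levelSum_mk_sub_mem g r)
        have e3 := Ideal.Quotient.eq.2 (hL'.levelSum_mk_sub_mem b s)
        rw [← Ideal.Quotient.eq, map_mul, e1, e2, e3, hφ, ← map_mul]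
        congr 1
        simp only [characterFun, ContinuousMap.coe_mk]
        ring
  have e := Ideal.Quotient.eq.2 (key (CompletedGroupAlgebra.proj R H a)
    (CompletedGroupAlgebra.proj R Q β))
  rw [← Ideal.Quotient.eq] at h1 h2 h3 ⊢
  rw [h1, e, map_mul, map_mul, h2, h3]

end Integral

end

noncomputable section

/-! ### Compactness of completed group algebras -/

section Compactness

variable {R : Type*} [CommRing R]

/-- Writes the coefficients of the image as finite sums of multiples of coefficients, from which
continuity can be read off. -/
theorem MonoidAlgebra.coeff_linearMap_apply {X Y : Type*} [Fintype X]
    (L : MonoidAlgebra R X →ₗ[R] MonoidAlgebra R Y) (x : MonoidAlgebra R X) (y : Y) :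
    (L x).coeff y = ∑ q, x.coeff q * (L (MonoidAlgebra.single q 1)).coeff y := by
  classical
  induction x using MonoidAlgebra.induction_linear with
  | zero => simp
  | add x x' hx hx' =>
    simp only [map_add, MonoidAlgebra.coeff_add, Finsupp.add_apply, hx, hx', add_mul,
      Finset.sum_add_distrib]
  | single q r =>
    rw [Finset.sum_eq_single q]
    · have : (MonoidAlgebra.single q r : MonoidAlgebra R X) = r • MonoidAlgebra.single q 1 := by
        simp
      rw [this, map_smul]
      simp
    · intro q' _ h
      simp [h.symm]
    · simp

variable {G : Type*} [Group G] [TopologicalSpace G]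

/-- The `R`-submodule generated by `1` and the left ideal spanned by the family `d`. -/
def scalarsSupLeftSpan {ι : Type*} (d : ι → CompletedGroupAlgebra R G) :
    Submodule R (CompletedGroupAlgebra R G) :=
  Submodule.span R {1} ⊔ (Submodule.span (CompletedGroupAlgebra R G) (Set.range d)).restrictScalars R

theorem smul_one_mem_scalarsSupLeftSpan {ι : Type*} (d : ι → CompletedGroupAlgebra R G) (r : R) :
    r • (1 : CompletedGroupAlgebra R G) ∈ scalarsSupLeftSpan d :=
  Submodule.mem_sup_left (Submodule.smul_mem _ _ (Submodule.mem_span_singleton_self _))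

theorem mem_scalarsSupLeftSpan_of_mem_span {ι : Type*} {d : ι → CompletedGroupAlgebra R G}
    {x : CompletedGroupAlgebra R G}
    (hx : x ∈ Submodule.span (CompletedGroupAlgebra R G) (Set.range d)) :
    x ∈ scalarsSupLeftSpan d :=
  Submodule.mem_sup_right hx

variable [TopologicalSpace R]

/-- The family of all coefficients of an element of `R[[G]]`. -/
def CompletedGroupAlgebra.coeffs (a : CompletedGroupAlgebra R G) :
    ∀ H : OpenNormalSubgroup G, G ⧸ H.toSubgroup → R :=
  fun H q => (CompletedGroupAlgebra.proj R H a).coeff q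

instance : TopologicalSpace (CompletedGroupAlgebra R G) :=
  TopologicalSpace.induced CompletedGroupAlgebra.coeffs inferInstance

omit [TopologicalSpace R] in
theorem CompletedGroupAlgebra.coeffs_injective :
    Function.Injective (CompletedGroupAlgebra.coeffs (R := R) (G := G)) := by
  intro a b h
  ext1; funext H
  exact MonoidAlgebra.coeff_injective (Finsupp.ext fun q => congrFun (congrFun h H) q)

omit [CommRing R] in
theorem continuous_apply_level (H : OpenNormalSubgroup G) (q : G ⧸ H.toSubgroup) :
    Continuous fun x : ∀ H : OpenNormalSubgroup G, G ⧸ H.toSubgroup → R => x H q := by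
  fun_prop

theorem CompletedGroupAlgebra.continuous_coeff (H : OpenNormalSubgroup G) (q : G ⧸ H.toSubgroup) :
    Continuous fun a : CompletedGroupAlgebra R G => (CompletedGroupAlgebra.proj R H a).coeff q :=
  (continuous_apply_level H q).comp
    (continuous_induced_dom (f := CompletedGroupAlgebra.coeffs (R := R) (G := G)))

theorem CompletedGroupAlgebra.tendsto_iff {ι : Type*} {F : Filter ι}
    {f : ι → CompletedGroupAlgebra R G} {a : CompletedGroupAlgebra R G} :
    Filter.Tendsto f F (nhds a) ↔ ∀ (H : OpenNormalSubgroup G) (q : G ⧸ H.toSubgroup),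
      Filter.Tendsto (fun i => (CompletedGroupAlgebra.proj R H (f i)).coeff q) F
        (nhds ((CompletedGroupAlgebra.proj R H a).coeff q)) := by
  rw [nhds_induced, Filter.tendsto_comap_iff, tendsto_pi_nhds]
  simp only [tendsto_pi_nhds]
  rfl

theorem CompletedGroupAlgebra.continuous_iff {X : Type*} [TopologicalSpace X]
    {f : X → CompletedGroupAlgebra R G} :
    Continuous f ↔ ∀ (H : OpenNormalSubgroup G) (q : G ⧸ H.toSubgroup),
      Continuous fun x => (CompletedGroupAlgebra.proj R H (f x)).coeff q := by
  simp only [continuous_iff_continuousAt, ContinuousAt, CompletedGroupAlgebra.tendsto_iff]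
  exact ⟨fun h H q x => h x H q, fun h x H q => h H q x⟩

instance [T2Space R] : T2Space (CompletedGroupAlgebra R G) :=
  .of_injective_continuous CompletedGroupAlgebra.coeffs_injective continuous_induced_dom

variable [IsTopologicalRing R]

instance : ContinuousAdd (CompletedGroupAlgebra R G) where
  continuous_add := by
    refine CompletedGroupAlgebra.continuous_iff.2 fun H q => ?_
    simp only [map_add, MonoidAlgebra.coeff_add, Finsupp.add_apply]
    exact ((CompletedGroupAlgebra.continuous_coeff H q).comp continuous_fst).add
      ((CompletedGroupAlgebra.continuous_coeff H q).comp continuous_snd)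

theorem CompletedGroupAlgebra.continuous_algebraMap :
    Continuous (algebraMap R (CompletedGroupAlgebra R G)) := by
  refine CompletedGroupAlgebra.continuous_iff.2 fun H q => ?_
  have : (fun r => (CompletedGroupAlgebra.proj R H
      (algebraMap R (CompletedGroupAlgebra R G) r)).coeff q) =
      fun r => r * (1 : MonoidAlgebra R (G ⧸ H.toSubgroup)).coeff q := by
    funext r
    rw [AlgHom.commutes, Algebra.algebraMap_eq_smul_one, MonoidAlgebra.coeff_smul_apply,
      smul_eq_mul]
  rw [this]
  fun_prop

variable [IsTopologicalGroup G]

omit [IsTopologicalRing R] in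
theorem CompletedGroupAlgebra.continuous_of :
    Continuous (CompletedGroupAlgebra.of R : G → CompletedGroupAlgebra R G) := by
  refine CompletedGroupAlgebra.continuous_iff.2 fun H q => ?_
  have : DiscreteTopology (G ⧸ H.toSubgroup) := QuotientGroup.discreteTopology H.isOpen'
  exact (continuous_of_discreteTopology (f := fun r : G ⧸ H.toSubgroup =>
    (MonoidAlgebra.single r (1 : R)).coeff q)).comp QuotientGroup.continuous_mk

variable [CompactSpace G]

instance (H : OpenNormalSubgroup G) : Finite (G ⧸ H.toSubgroup) :=
  H.toSubgroup.quotient_finite_of_isOpen H.isOpen'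

theorem CompletedGroupAlgebra.continuous_mul_right (d : CompletedGroupAlgebra R G) :
    Continuous fun a => a * d := by
  refine CompletedGroupAlgebra.continuous_iff.2 fun H q => ?_
  have := Fintype.ofFinite (G ⧸ H.toSubgroup)
  have h : ∀ a, (CompletedGroupAlgebra.proj R H (a * d)).coeff q =
      ∑ r, (CompletedGroupAlgebra.proj R H a).coeff r *
        (MonoidAlgebra.single r 1 * CompletedGroupAlgebra.proj R H d).coeff q := fun a => by
    rw [map_mul (CompletedGroupAlgebra.proj R H)]
    exact MonoidAlgebra.coeff_linearMap_apply
      (LinearMap.mulRight R (CompletedGroupAlgebra.proj R H d)) _ q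
  simp only [h]
  exact continuous_finsetSum _ fun r _ =>
    (CompletedGroupAlgebra.continuous_coeff H r).mul continuous_const

/-- The compatibility conditions are equations between finite linear combinations of coordinates,
hence closed. -/
theorem CompletedGroupAlgebra.isClosed_range_coeffs [T2Space R] :
    IsClosed (Set.range (CompletedGroupAlgebra.coeffs (R := R) (G := G))) := by
  have hF := fun H : OpenNormalSubgroup G => Fintype.ofFinite (G ⧸ H.toSubgroup)
  have : Set.range (CompletedGroupAlgebra.coeffs (R := R) (G := G)) =
      {x | ∀ (H H' : OpenNormalSubgroup G) (h : H ≤ H') (q : G ⧸ H'.toSubgroup),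
        ∑ r, x H r * (groupAlgebraTransition R h (MonoidAlgebra.single r 1)).coeff q = x H' q} := by
    ext x
    constructor
    · rintro ⟨a, rfl⟩ H H' h q
      rw [CompletedGroupAlgebra.coeffs, ← CompletedGroupAlgebra.transition_proj R h]
      exact (MonoidAlgebra.coeff_linearMap_apply
        (groupAlgebraTransition R h).toLinearMap (CompletedGroupAlgebra.proj R H a) q).symm
    · intro hx
      refine ⟨⟨fun H => .ofCoeff (Finsupp.equivFunOnFinite.symm (x H)), fun H H' h => ?_⟩, ?_⟩
      · refine MonoidAlgebra.coeff_injective (Finsupp.ext fun q => ?_)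
        refine (MonoidAlgebra.coeff_linearMap_apply
          (groupAlgebraTransition R h).toLinearMap _ q).trans ?_
        simpa using hx H H' h q
      · rfl
  rw [this]
  simp only [Set.ofPred_forall]
  refine isClosed_iInter fun H => isClosed_iInter fun H' => isClosed_iInter fun h =>
    isClosed_iInter fun q => isClosed_eq ?_ ?_
  · exact continuous_finsetSum _ fun r _ =>
      (continuous_apply_level H r).mul continuous_const
  · exact continuous_apply_level H' q

instance [T2Space R] [CompactSpace R] : CompactSpace (CompletedGroupAlgebra R G) := by
  have h : Topology.IsClosedEmbedding (CompletedGroupAlgebra.coeffs (R := R) (G := G)) :=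
    ⟨⟨⟨rfl⟩, CompletedGroupAlgebra.coeffs_injective⟩,
      CompletedGroupAlgebra.isClosed_range_coeffs⟩
  exact h.compactSpace

/-- With finitely many generators the left ideal is the image of a compact space under `c ↦ ∑ i, c i
* d i`. -/
theorem isClosed_leftSpan [T2Space R] [CompactSpace R] {ι : Type*} [Fintype ι]
    (d : ι → CompletedGroupAlgebra R G) :
    IsClosed (Submodule.span (CompletedGroupAlgebra R G) (Set.range d) :
      Set (CompletedGroupAlgebra R G)) := by
  have : (Submodule.span (CompletedGroupAlgebra R G) (Set.range d) :
      Set (CompletedGroupAlgebra R G)) =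
      Set.range fun c : ι → CompletedGroupAlgebra R G => ∑ i, c i * d i :=
    Set.ext fun a => Submodule.mem_span_range_iff_exists_fun _
  rw [this]
  exact (isCompact_range (continuous_finsetSum _ fun i _ =>
    (CompletedGroupAlgebra.continuous_mul_right (d i)).comp (continuous_apply i))).isClosed

theorem isClosed_scalarsSupLeftSpan [T2Space R] [CompactSpace R] {ι : Type*} [Fintype ι]
    (d : ι → CompletedGroupAlgebra R G) :
    IsClosed (scalarsSupLeftSpan d : Set (CompletedGroupAlgebra R G)) := by
  have : (scalarsSupLeftSpan d : Set (CompletedGroupAlgebra R G)) =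
      Set.range fun x : R × (ι → CompletedGroupAlgebra R G) =>
        algebraMap R _ x.1 + ∑ i, x.2 i * d i := by
    ext a
    rw [SetLike.mem_coe, scalarsSupLeftSpan, Submodule.mem_sup]
    constructor
    · rintro ⟨y, hy, z, hz, rfl⟩
      obtain ⟨r, rfl⟩ := Submodule.mem_span_singleton.1 hy
      obtain ⟨c, rfl⟩ := (Submodule.mem_span_range_iff_exists_fun _).1 hz
      exact ⟨(r, c), by simp [Algebra.algebraMap_eq_smul_one]⟩
    · rintro ⟨⟨r, c⟩, rfl⟩
      refine ⟨r • 1, Submodule.mem_span_singleton.2 ⟨r, rfl⟩, _,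
        (Submodule.mem_span_range_iff_exists_fun _).2 ⟨c, rfl⟩, ?_⟩
      simp [Algebra.algebraMap_eq_smul_one]
  rw [this]
  refine (isCompact_range ?_).isClosed
  refine (CompletedGroupAlgebra.continuous_algebraMap.comp continuous_fst).add
    (continuous_finsetSum _ fun i _ => ?_)
  exact (CompletedGroupAlgebra.continuous_mul_right (d i)).comp
    ((continuous_apply i).comp continuous_snd)

theorem mem_scalarsSupLeftSpan_of_approx [T2Space R] [CompactSpace R] {I : Ideal R} (hI : IsAdic I)
    {ι : Type*} [Fintype ι] (d : ι → CompletedGroupAlgebra R G) (x : CompletedGroupAlgebra R G)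
    (hx : ∀ (H : OpenNormalSubgroup G) (m : ℕ), ∃ z ∈ scalarsSupLeftSpan d,
      CompletedGroupAlgebra.proj R H (z - x) ∈
        I ^ m • (⊤ : Submodule R (MonoidAlgebra R (G ⧸ H.toSubgroup)))) :
    x ∈ scalarsSupLeftSpan d := by
  choose z hz hzx using hx
  -- The net is indexed by pairs (level, precision), with levels in reverse order so that they
  -- shrink; nonemptiness makes `atTop` a proper filter.
  have : Nonempty (OpenNormalSubgroup G) := ⟨⊤, inferInstanceAs (⊤ : Subgroup G).Normal⟩
  refine (isClosed_scalarsSupLeftSpan d).mem_of_tendsto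
    (f := fun i : (OpenNormalSubgroup G)ᵒᵈ × ℕ => z (OrderDual.ofDual i.1) i.2)
    (b := Filter.atTop) ?_ (Filter.Eventually.of_forall fun i => hz _ _)
  rw [CompletedGroupAlgebra.tendsto_iff]
  intro H q
  rw [← tendsto_sub_nhds_zero_iff, hI.hasBasis_nhds_zero.tendsto_right_iff]
  intro m _
  filter_upwards [Filter.eventually_ge_atTop (OrderDual.toDual H, m)] with i hi
  have h1 : OrderDual.ofDual i.1 ≤ H := hi.1
  -- An approximation at a finer level is pushed down to `H`, then to the coefficient at `q`.
  have h2 := Submodule.mem_map_of_mem (f := (groupAlgebraTransition R h1).toLinearMap)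
    (hzx (OrderDual.ofDual i.1) i.2)
  rw [Submodule.map_smul'', AlgHom.toLinearMap_apply,
    CompletedGroupAlgebra.transition_proj R h1] at h2
  have h3 := Submodule.mem_map_of_mem (f := Finsupp.lapply q ∘ₗ
    (MonoidAlgebra.coeffLinearEquiv R).toLinearMap)
    (Submodule.smul_mono (Ideal.pow_le_pow_right hi.2) (le_top : _ ≤ ⊤) h2)
  rw [Submodule.map_smul''] at h3
  have h4 := Submodule.smul_mono (le_refl (I ^ m)) (le_top : _ ≤ ⊤) h3
  rw [smul_eq_mul, Ideal.mul_top, map_sub (CompletedGroupAlgebra.proj R H), map_sub] at h4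
  exact h4

end Compactness

end

noncomputable section

/-! ### Topological generators -/

section UnitGenerators

variable (p : ℕ) [Fact p.Prime]

theorem PadicInt.pow_dvd_iff_toZModPow_eq (n : ℕ) (x y : ℤ_[p]) :
    (p : ℤ_[p]) ^ n ∣ x - y ↔ toZModPow n x = toZModPow n y := by
  rw [← Ideal.mem_span_singleton, ← ker_toZModPow, RingHom.mem_ker, map_sub, sub_eq_zero]

theorem PadicInt.exists_finset_units_lift (n : ℕ) :
    ∃ S : Finset ℤ_[p]ˣ, ∀ u : ℤ_[p]ˣ, ∃ s ∈ S, (p : ℤ_[p]) ^ n ∣ s - u := by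
  classical
  have : NeZero (p ^ n) := ⟨pow_ne_zero _ (Fact.out : p.Prime).ne_zero⟩
  refine ⟨Finset.univ.image fun r : ZMod (p ^ n) =>
    -- Residues that do not lift to a unit contribute the harmless element `1`.
    if h : ∃ u : ℤ_[p]ˣ, toZModPow n (u : ℤ_[p]) = r then h.choose else 1, fun u => ?_⟩
  have h : ∃ v : ℤ_[p]ˣ, toZModPow n (v : ℤ_[p]) = toZModPow n (u : ℤ_[p]) := ⟨u, rfl⟩
  refine ⟨h.choose, Finset.mem_image.2 ⟨toZModPow n (u : ℤ_[p]), Finset.mem_univ _, ?_⟩, ?_⟩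
  · rw [dif_pos h]
  · exact (PadicInt.pow_dvd_iff_toZModPow_eq p n _ _).2 h.choose_spec

theorem PadicInt.isUnit_one_add_of_dvd {x : ℤ_[p]} (h : (p : ℤ_[p]) ∣ x) : IsUnit (1 + x) := by
  by_contra hu
  have h1 : 1 + x ∈ IsLocalRing.maximalIdeal ℤ_[p] := hu
  have h2 : x ∈ IsLocalRing.maximalIdeal ℤ_[p] := by
    rw [PadicInt.maximalIdeal_eq_span_p]
    exact Ideal.mem_span_singleton.2 h
  have h3 : (1 : ℤ_[p]) ∈ IsLocalRing.maximalIdeal ℤ_[p] := by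
    simpa using Ideal.sub_mem _ h1 h2
  exact h3 isUnit_one

/-- The `p`-th power map takes `1 + p ^ (n+2) * w` to `1 + p ^ (n+3) * w` modulo `p ^ (n+4)`. The
quadratic remainder is divisible by `p ^ (2n+4)`, so beginning at exponent `2` works for every `p`,
including `2`; hence the residues modulo `p ^ 3`. -/
theorem PadicInt.exists_mem_closure_near_one {S : Set ℤ_[p]ˣ}
    (hS : ∀ u : ℤ_[p]ˣ, ∃ s ∈ S, (p : ℤ_[p]) ^ 3 ∣ s - u) (n : ℕ) (v : ℤ_[p]) :
    ∃ s ∈ Subgroup.closure S, (p : ℤ_[p]) ^ (n + 3) ∣ s - (1 + p ^ (n + 2) * v) := by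
  induction n with
  | zero =>
    obtain ⟨u, hu⟩ := PadicInt.isUnit_one_add_of_dvd p (x := p ^ 2 * v)
      ((dvd_pow_self _ two_ne_zero).mul_right v)
    obtain ⟨s, hs, h⟩ := hS u
    exact ⟨s, Subgroup.subset_closure hs, by simpa [hu] using h⟩
  | succ n ih =>
    obtain ⟨s, hs, c, hc⟩ := ih
    refine ⟨s ^ p, pow_mem hs p, ?_⟩
    have hs' : (s : ℤ_[p]) = 1 + p ^ (n + 2) * (v + p * c) := by
      linear_combination hc
    obtain ⟨k, hk⟩ := Polynomial.powAddExpansion (1 : ℤ_[p]) (p ^ (n + 2) * (v + p * c)) p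
    rw [Units.val_pow_eq_pow_val, hs', hk]
    refine ⟨c + k * p ^ n * (v + p * c) ^ 2, ?_⟩
    simp only [one_pow, mul_one]
    ring

theorem PadicInt.exists_mem_closure_near {S : Set ℤ_[p]ˣ}
    (hS : ∀ u : ℤ_[p]ˣ, ∃ s ∈ S, (p : ℤ_[p]) ^ 3 ∣ s - u) (n : ℕ) (u : ℤ_[p]ˣ) :
    ∃ s ∈ Subgroup.closure S, (p : ℤ_[p]) ^ (n + 2) ∣ s - u := by
  induction n with
  | zero =>
    obtain ⟨s, hs, h⟩ := hS u
    exact ⟨s, Subgroup.subset_closure hs, (pow_dvd_pow _ (by norm_num)).trans h⟩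
  | succ n ih =>
    obtain ⟨w, hw, c, hc⟩ := ih
    -- The factor `1 - p ^ (n+2) * c / w` cancels the error `w - u = p ^ (n+2) * c`.
    obtain ⟨s, hs, e, he⟩ := PadicInt.exists_mem_closure_near_one p hS n (-c * (w⁻¹ : ℤ_[p]ˣ))
    refine ⟨s * w, mul_mem hs hw, e * w, ?_⟩
    have hw1 : ((w⁻¹ : ℤ_[p]ˣ) : ℤ_[p]) * w = 1 := by simp
    rw [Units.val_mul]
    linear_combination (w : ℤ_[p]) * he + hc - p ^ (n + 2) * c * hw1

theorem PadicInt.exists_finset_dense_units :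
    ∃ S : Finset ℤ_[p]ˣ, ∀ C : Subgroup ℤ_[p]ˣ, IsClosed (C : Set ℤ_[p]ˣ) →
      (∀ s ∈ S, s ∈ C) → C = ⊤ := by
  obtain ⟨S, hS⟩ := PadicInt.exists_finset_units_lift p 3
  refine ⟨S, fun C hC hSC => (Subgroup.eq_top_iff' C).2 fun u => ?_⟩
  have hle : Subgroup.closure (S : Set ℤ_[p]ˣ) ≤ C := (Subgroup.closure_le C).2 hSC
  choose s hs c hc using fun n => PadicInt.exists_mem_closure_near p (S := S) hS n u
  refine hC.mem_of_tendsto (f := s) (b := Filter.atTop) ?_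
    (Filter.Eventually.of_forall fun n => hle (hs n))
  rw [Units.isOpenEmbedding_val.isInducing.tendsto_nhds_iff, ← tendsto_sub_nhds_zero_iff]
  have hlt : ‖(p : ℤ_[p])‖ < 1 := by
    rw [PadicInt.norm_p]
    exact inv_lt_one_of_one_lt₀ (mod_cast (Fact.out : p.Prime).one_lt)
  refine squeeze_zero_norm (a := fun n => ‖(p : ℤ_[p])‖ ^ (n + 2)) (fun n => ?_)
    ((tendsto_pow_atTop_nhds_zero_of_lt_one (norm_nonneg _) hlt).comp (Filter.tendsto_add_atTop_nat 2))
  simp only [Function.comp_apply]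
  rw [hc, norm_mul, norm_pow]
  exact mul_le_of_le_one_right (by positivity) (PadicInt.norm_le_one _)

end UnitGenerators

/-! ### Topology and generators of the lower triangular group -/

section LowerTriangular

variable (p : ℕ) [Fact p.Prime]

instance : CompactSpace (Matrix (Fin 2) (Fin 2) ℤ_[p]) :=
  inferInstanceAs (CompactSpace (Fin 2 → Fin 2 → ℤ_[p]))

instance : TotallyDisconnectedSpace (Matrix (Fin 2) (Fin 2) ℤ_[p]) :=
  inferInstanceAs (TotallyDisconnectedSpace (Fin 2 → Fin 2 → ℤ_[p]))

instance : CompactSpace (GL (Fin 2) ℤ_[p]) :=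
  inferInstanceAs (CompactSpace (Matrix (Fin 2) (Fin 2) ℤ_[p])ˣ)

instance : TotallyDisconnectedSpace (GL (Fin 2) ℤ_[p]) :=
  ⟨fun s _ hs => (isTotallyDisconnected_of_image (f := Units.val) Units.continuous_val.continuousOn
    Units.val_injective (isTotallyDisconnected_of_totallyDisconnectedSpace
      (Units.val '' (s : Set (Matrix (Fin 2) (Fin 2) ℤ_[p])ˣ)))) s subset_rfl hs⟩

theorem continuous_GL_entry (i j : Fin 2) : Continuous fun g : GL (Fin 2) ℤ_[p] => g i j :=
  Units.continuous_val.matrix_elem i j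

theorem isClosed_lowerTriangular : IsClosed (lowerTriangular p : Set (GL (Fin 2) ℤ_[p])) :=
  isClosed_eq (continuous_GL_entry p 0 1) continuous_const

instance : CompactSpace (lowerTriangular p) :=
  isCompact_iff_compactSpace.1 (isClosed_lowerTriangular p).isCompact

/-- The lower unipotent matrix with entry `y`. -/
def lowerUnipotent (y : ℤ_[p]) : GL (Fin 2) ℤ_[p] where
  val := !![1, 0; y, 1]
  inv := !![1, 0; -y, 1]
  val_inv := by simp [Matrix.one_fin_two]
  inv_val := by simp [Matrix.one_fin_two]

theorem lowerUnipotent_add (x y : ℤ_[p]) :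
    lowerUnipotent p (x + y) = lowerUnipotent p x * lowerUnipotent p y := by
  ext i j
  fin_cases i <;> fin_cases j <;> simp [lowerUnipotent]

theorem lowerUnipotent_zero : lowerUnipotent p 0 = 1 := by
  ext i j
  fin_cases i <;> fin_cases j <;> simp [lowerUnipotent]

theorem lowerUnipotent_neg (y : ℤ_[p]) : lowerUnipotent p (-y) = (lowerUnipotent p y)⁻¹ := by
  rw [eq_inv_iff_mul_eq_one, ← lowerUnipotent_add, neg_add_cancel, lowerUnipotent_zero]

theorem continuous_lowerUnipotent : Continuous (lowerUnipotent p) := by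
  refine Units.continuous_iff.2 ⟨continuous_matrix fun i j => ?_, continuous_matrix fun i j => ?_⟩ <;>
  fin_cases i <;> fin_cases j <;>
  simp [lowerUnipotent, continuous_const, continuous_id', continuous_neg]

theorem lowerUnipotent_mem (y : ℤ_[p]) : lowerUnipotent p y ∈ lowerTriangular p := rfl

/-- The diagonal matrix with entries `u` and `v`, as an element of `P`. -/
def diagonalElement : ℤ_[p]ˣ × ℤ_[p]ˣ →* lowerTriangular p where
  toFun u := ⟨{ val := !![(u.1 : ℤ_[p]), 0; 0, (u.2 : ℤ_[p])]
                inv := !![((u.1⁻¹ : ℤ_[p]ˣ) : ℤ_[p]), 0; 0, ((u.2⁻¹ : ℤ_[p]ˣ) : ℤ_[p])]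
                val_inv := by simp [Matrix.one_fin_two]
                inv_val := by simp [Matrix.one_fin_two] }, rfl⟩
  map_one' := by
    ext i j
    fin_cases i <;> fin_cases j <;> simp
  map_mul' u v := by
    ext i j
    fin_cases i <;> fin_cases j <;> simp

theorem continuous_diagonalElement : Continuous (diagonalElement p) := by
  refine Continuous.subtype_mk (Units.continuous_iff.2 ⟨continuous_matrix fun i j => ?_,
    continuous_matrix fun i j => ?_⟩) _ <;>
  fin_cases i <;> fin_cases j
  exacts [Units.continuous_val.comp continuous_fst, continuous_const, continuous_const,
    Units.continuous_val.comp continuous_snd,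
    Units.continuous_val.comp (continuous_inv.comp continuous_fst), continuous_const,
    continuous_const, Units.continuous_val.comp (continuous_inv.comp continuous_snd)]

theorem lowerTriangular_decomposition (b : lowerTriangular p) :
    ∃ (u : ℤ_[p]ˣ × ℤ_[p]ˣ) (y : ℤ_[p]),
      b = diagonalElement p u * ⟨lowerUnipotent p y, lowerUnipotent_mem p y⟩ := by
  have h0 := lowerTriangular_apply_mul_inv p b 0
  have h1 := lowerTriangular_apply_mul_inv p b 1
  obtain ⟨y, hy⟩ : ∃ y, b.1 1 1 * y = b.1 1 0 :=
    ⟨(b⁻¹).1 1 1 * b.1 1 0, by rw [← mul_assoc, h1, one_mul]⟩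
  refine ⟨(⟨_, _, h0, by rwa [mul_comm] at h0⟩, ⟨_, _, h1, by rwa [mul_comm] at h1⟩), y, ?_⟩
  have hb : b.1 0 1 = 0 := b.2
  refine Subtype.ext (Units.ext ?_)
  change b.1.val = !![b.1 0 0, 0; 0, b.1 1 1] * !![1, 0; y, 1]
  rw [Matrix.mul_fin_two, Matrix.eta_fin_two b.1.val]
  simp [hy, hb]

/-- The group `P` is topologically finitely generated. -/
theorem exists_finset_dense_lowerTriangular :
    ∃ S : Finset (lowerTriangular p), ∀ C : Subgroup (lowerTriangular p),
      IsClosed (C : Set (lowerTriangular p)) → (∀ s ∈ S, s ∈ C) → C = ⊤ := by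
  classical
  obtain ⟨S, hS⟩ := PadicInt.exists_finset_dense_units p
  refine ⟨S.image (fun s => diagonalElement p (s, 1)) ∪
    S.image (fun s => diagonalElement p (1, s)) ∪
    {⟨lowerUnipotent p 1, lowerUnipotent_mem p 1⟩}, fun C hC hSC => ?_⟩
  have hcont := continuous_diagonalElement p
  have h1 : C.comap ((diagonalElement p).comp (MonoidHom.inl _ _)) = ⊤ := by
    refine hS _ (hC.preimage (hcont.comp (Continuous.prodMk_left 1))) fun s hs => ?_
    exact hSC (diagonalElement p (s, 1)) (by
      exact Finset.mem_union_left _ (Finset.mem_union_left _ (Finset.mem_image_of_mem _ hs)))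
  have h2 : C.comap ((diagonalElement p).comp (MonoidHom.inr _ _)) = ⊤ := by
    refine hS _ (hC.preimage (hcont.comp (Continuous.prodMk_right 1))) fun s hs => ?_
    exact hSC (diagonalElement p (1, s)) (by
      exact Finset.mem_union_left _ (Finset.mem_union_right _ (Finset.mem_image_of_mem _ hs)))
  have h3 : ∀ y : ℤ_[p],
      (⟨lowerUnipotent p y, lowerUnipotent_mem p y⟩ : lowerTriangular p) ∈ C := by
    intro y
    -- The natural numbers are dense in `ℤ_p`, so a single unipotent generator suffices.
    refine PadicInt.denseRange_natCast.induction_on (p := fun y : ℤ_[p] =>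
      (⟨lowerUnipotent p y, lowerUnipotent_mem p y⟩ : lowerTriangular p) ∈ C) y
      (hC.preimage ((continuous_lowerUnipotent p).subtype_mk _)) fun n => ?_
    induction n with
    | zero =>
      have : (⟨lowerUnipotent p (0 : ℕ), lowerUnipotent_mem p _⟩ : lowerTriangular p) = 1 := by
        refine Subtype.ext ?_
        exact (congrArg (lowerUnipotent p) Nat.cast_zero).trans (lowerUnipotent_zero p)
      rw [this]
      exact C.one_mem
    | succ n ih =>
      have : (⟨lowerUnipotent p (n + 1 : ℕ), lowerUnipotent_mem p _⟩ : lowerTriangular p) =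
          ⟨lowerUnipotent p n, lowerUnipotent_mem p _⟩ *
            ⟨lowerUnipotent p 1, lowerUnipotent_mem p _⟩ := by
        refine Subtype.ext ?_
        exact (congrArg (lowerUnipotent p) (Nat.cast_succ n)).trans (lowerUnipotent_add p n 1)
      rw [this]
      exact C.mul_mem ih (hSC _ (Finset.mem_union_right _ (Finset.mem_singleton_self _)))
  refine (Subgroup.eq_top_iff' C).2 fun b => ?_
  obtain ⟨u, y, rfl⟩ := lowerTriangular_decomposition p b
  refine C.mul_mem ?_ (h3 y)
  have hu : u = MonoidHom.inl ℤ_[p]ˣ ℤ_[p]ˣ u.1 * MonoidHom.inr ℤ_[p]ˣ ℤ_[p]ˣ u.2 := by simp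
  rw [hu, map_mul]
  exact C.mul_mem ((Subgroup.eq_top_iff' _).1 h1 u.1) ((Subgroup.eq_top_iff' _).1 h2 u.2)

end LowerTriangular

end

noncomputable section

/-! ### Equivariant functions supported on orbits of the unipotent group -/

section OrbitFunctions

variable {p : ℕ} [Fact p.Prime]

theorem PadicInt.dvd_of_norm_le {x y : ℤ_[p]} (hy : y ≠ 0) (h : ‖x‖ ≤ ‖y‖) : y ∣ x := by
  have hy' : (y : ℚ_[p]) ≠ 0 := fun h => hy (Subtype.ext h)
  refine ⟨⟨(x : ℚ_[p]) / y, ?_⟩, ?_⟩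
  · rw [norm_div]
    exact div_le_one_of_le₀ h (norm_nonneg _)
  · refine Subtype.ext ?_
    change (x : ℚ_[p]) = y * (x / y)
    rw [mul_div_cancel₀ _ hy']

theorem PadicInt.isClopen_dvd_pow (k : ℕ) : IsClopen {z : ℤ_[p] | (p : ℤ_[p]) ^ k ∣ z} := by
  have : {z : ℤ_[p] | (p : ℤ_[p]) ^ k ∣ z} = Metric.closedBall 0 ((p : ℝ) ^ (-k : ℤ)) := by
    ext z
    rw [mem_closedBall_zero_iff, PadicInt.norm_le_pow_iff_mem_span_pow, Ideal.mem_span_singleton]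
    rfl
  rw [this]
  exact IsUltrametricDist.isClopen_closedBall _
    (zpow_ne_zero _ (mod_cast (Fact.out : p.Prime).ne_zero))

theorem lowerUnipotent_mul_apply_zero (z : ℤ_[p]) (g : GL (Fin 2) ℤ_[p]) (j : Fin 2) :
    (lowerUnipotent p z * g) 0 j = g 0 j := by
  simp [lowerUnipotent, Matrix.mul_apply]

theorem lowerUnipotent_mul_apply_one (z : ℤ_[p]) (g : GL (Fin 2) ℤ_[p]) (j : Fin 2) :
    (lowerUnipotent p z * g) 1 j = z * g 0 j + g 1 j := by
  simp [lowerUnipotent, Matrix.mul_apply]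

/-- Right multiplication by `P` only rescales the second column, whose line is therefore the point
of `G/P`. -/
theorem mul_lowerTriangular_apply_one (g : GL (Fin 2) ℤ_[p]) (b : lowerTriangular p) (i : Fin 2) :
    (g * b.1) i 1 = g i 1 * b.1 1 1 := by
  have hb : b.1 0 1 = 0 := b.2
  simp [Matrix.mul_apply, hb]

theorem mem_lowerTriangular_of_smul_column {g x : GL (Fin 2) ℤ_[p]} {u : ℤ_[p]}
    (h : ∀ i, x i 1 = g i 1 * u) : g⁻¹ * x ∈ lowerTriangular p := by
  change (g⁻¹ * x) 0 1 = 0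
  have h1 : (g⁻¹ * g) 0 1 = 0 := by simp
  rw [Units.val_mul, Matrix.mul_apply, Fin.sum_univ_two] at h1 ⊢
  rw [h, h]
  linear_combination u * h1

/-- The parametrization `(z, b) ↦ n(z) g b` of the double coset `N g P`. -/
def orbitMap (g : GL (Fin 2) ℤ_[p]) (x : ℤ_[p] × lowerTriangular p) : GL (Fin 2) ℤ_[p] :=
  lowerUnipotent p x.1 * g * x.2.1

theorem continuous_orbitMap (g : GL (Fin 2) ℤ_[p]) : Continuous (orbitMap g) :=
  (((continuous_lowerUnipotent p).comp continuous_fst).mul continuous_const).mul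
    (continuous_subtype_val.comp continuous_snd)

theorem orbitMap_apply_zero (g : GL (Fin 2) ℤ_[p]) (x : ℤ_[p] × lowerTriangular p) :
    orbitMap g x 0 1 = g 0 1 * x.2.1 1 1 := by
  rw [orbitMap, mul_lowerTriangular_apply_one, lowerUnipotent_mul_apply_zero]

theorem orbitMap_apply_one (g : GL (Fin 2) ℤ_[p]) (x : ℤ_[p] × lowerTriangular p) :
    orbitMap g x 1 1 = (x.1 * g 0 1 + g 1 1) * x.2.1 1 1 := by
  rw [orbitMap, mul_lowerTriangular_apply_one, lowerUnipotent_mul_apply_one]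

theorem lowerTriangular_isUnit (b : lowerTriangular p) : IsUnit (b.1 1 1) :=
  IsUnit.of_mul_eq_one _ (lowerTriangular_apply_mul_inv p b 1)

/-- On the slope `g 1 1 / g 0 1` of the second column, `n(z)` acts as translation by `z` and `P`
acts trivially, so the action of `N` off the base point is free. -/
theorem orbitMap_injective {g : GL (Fin 2) ℤ_[p]} (hg : g 0 1 ≠ 0) :
    Function.Injective (orbitMap g) := by
  intro x y h
  have h0 : orbitMap g x 0 1 = orbitMap g y 0 1 := by rw [h]
  have h1 : orbitMap g x 1 1 = orbitMap g y 1 1 := by rw [h]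
  rw [orbitMap_apply_zero, orbitMap_apply_zero] at h0
  rw [orbitMap_apply_one, orbitMap_apply_one, mul_left_cancel₀ hg h0] at h1
  have h2 := mul_right_cancel₀ (lowerTriangular_isUnit y.2).ne_zero h1
  have h3 : x.1 = y.1 := mul_right_cancel₀ hg (add_right_cancel h2)
  refine Prod.ext h3 (Subtype.ext ?_)
  rw [orbitMap, orbitMap, h3] at h
  exact mul_left_cancel h

/-- The conditions say that `x 0 1` is a unit multiple of `g 0 1` and that the two slopes differ by
an element of `ℤ_p`. They are open, which is why this form is wanted. -/
theorem range_orbitMap {g : GL (Fin 2) ℤ_[p]} (hg : g 0 1 ≠ 0) :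
    Set.range (orbitMap g) =
      {x | ‖x 0 1‖ = ‖g 0 1‖ ∧ ‖x 1 1 * g 0 1 - g 1 1 * x 0 1‖ ≤ ‖g 0 1 ^ 2‖} := by
  ext x
  constructor
  · rintro ⟨⟨z, b⟩, rfl⟩
    have hb : ‖b.1 1 1‖ = 1 := PadicInt.isUnit_iff.1 (lowerTriangular_isUnit b)
    refine ⟨by rw [orbitMap_apply_zero, norm_mul, hb, mul_one], ?_⟩
    rw [orbitMap_apply_zero, orbitMap_apply_one]
    have : (z * g 0 1 + g 1 1) * b.1 1 1 * g 0 1 - g 1 1 * (g 0 1 * b.1 1 1) =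
        z * b.1 1 1 * g 0 1 ^ 2 := by ring
    rw [this, norm_mul]
    exact mul_le_of_le_one_left (norm_nonneg _) (PadicInt.norm_le_one _)
  · rintro ⟨h0, h1⟩
    obtain ⟨u, hu⟩ := PadicInt.dvd_of_norm_le hg h0.le
    obtain ⟨w, hw⟩ := PadicInt.dvd_of_norm_le (pow_ne_zero 2 hg) h1
    have hun : IsUnit u := by
      rw [PadicInt.isUnit_iff]
      rw [hu, norm_mul] at h0
      exact mul_left_cancel₀ (norm_ne_zero_iff.2 hg) (h0.trans (mul_one _).symm)
    obtain ⟨u, rfl⟩ := hun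
    have h11 : x 1 1 = g 1 1 * u + g 0 1 * w := by
      refine mul_right_cancel₀ hg ?_
      linear_combination hw + g 1 1 * hu
    -- The difference of the slopes of `x` and `g` is `w / u`.
    refine ⟨(w * (u⁻¹ : ℤ_[p]ˣ), ⟨(lowerUnipotent p (w * (u⁻¹ : ℤ_[p]ˣ)) * g)⁻¹ * x,
      mem_lowerTriangular_of_smul_column (u := u) fun i => ?_⟩), ?_⟩
    · fin_cases i
      · exact hu.trans (congrArg (· * (u : ℤ_[p])) (lowerUnipotent_mul_apply_zero _ g 1).symm)
      · refine h11.trans ?_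
        refine Eq.trans ?_
          (congrArg (· * (u : ℤ_[p])) (lowerUnipotent_mul_apply_one _ g 1).symm)
        have hu1 : ((u⁻¹ : ℤ_[p]ˣ) : ℤ_[p]) * u = 1 := by simp
        linear_combination (-(w * g 0 1)) * hu1
    · exact mul_inv_cancel_left _ _

theorem isOpen_range_orbitMap {g : GL (Fin 2) ℤ_[p]} (hg : g 0 1 ≠ 0) :
    IsOpen (Set.range (orbitMap g)) := by
  rw [range_orbitMap hg]
  have h0 := continuous_GL_entry p 0 1
  have h1 := continuous_GL_entry p 1 1
  have e0 : IsOpen {x : GL (Fin 2) ℤ_[p] | ‖x 0 1‖ = ‖g 0 1‖} := by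
    have := (IsUltrametricDist.isOpen_sphere (0 : ℤ_[p]) (norm_ne_zero_iff.2 hg)).preimage h0
    simpa [Set.preimage] using this
  have e1 : IsOpen {x : GL (Fin 2) ℤ_[p] |
      ‖x 1 1 * g 0 1 - g 1 1 * x 0 1‖ ≤ ‖g 0 1 ^ 2‖} := by
    have := (IsUltrametricDist.isOpen_closedBall (0 : ℤ_[p])
      (norm_ne_zero_iff.2 (pow_ne_zero 2 hg))).preimage
      ((h1.mul continuous_const).sub (continuous_const.mul h0) : Continuous
        fun x : GL (Fin 2) ℤ_[p] => x 1 1 * g 0 1 - g 1 1 * x 0 1)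
    simpa [Set.preimage] using this
  exact e0.inter e1

theorem isClosedEmbedding_orbitMap {g : GL (Fin 2) ℤ_[p]} (hg : g 0 1 ≠ 0) :
    Topology.IsClosedEmbedding (orbitMap g) :=
  (continuous_orbitMap g).isClosedEmbedding (orbitMap_injective hg)

/-- The image is open and closed, so the function and its zero extension glue. -/
theorem Topology.IsClosedEmbedding.continuous_extend_zero {X Y Z : Type*} [TopologicalSpace X]
    [TopologicalSpace Y] [TopologicalSpace Z] [Zero Z] {e : X → Y}
    (he : Topology.IsClosedEmbedding e) (ho : IsOpen (Set.range e)) {f : X → Z}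
    (hf : Continuous f) : Continuous (Function.extend e f 0) := by
  refine continuous_iff_continuousAt.2 fun y => ?_
  by_cases hy : y ∈ Set.range e
  · obtain ⟨x, rfl⟩ := hy
    refine (Topology.IsOpenEmbedding.continuousAt_iff ⟨he.isEmbedding, ho⟩).1 ?_
    rw [Function.extend_comp he.injective]
    exact hf.continuousAt
  · refine continuousAt_const (y := (0 : Z)) |>.congr ?_
    filter_upwards [he.isClosed_range.isOpen_compl.mem_nhds hy] with w hw
    exact (Function.extend_apply' f (0 : Y → Z) w hw).symm

variable {R : Type*} [CommRing R] [TopologicalSpace R]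
  (ψ : lowerTriangular p →ₜ* Rˣ)

open Classical in
/-- The function equal to `ψ(b)` at `n(z) g b` for `p ^ k ∣ z`, and to `0` elsewhere. -/
def orbitFun {g : GL (Fin 2) ℤ_[p]} (hg : g 0 1 ≠ 0) (k : ℕ) : C(GL (Fin 2) ℤ_[p], R) :=
  ⟨Function.extend (orbitMap g)
    (fun x => if (p : ℤ_[p]) ^ k ∣ x.1 then ((ψ x.2 : Rˣ) : R) else 0) 0,
    (isClosedEmbedding_orbitMap hg).continuous_extend_zero (isOpen_range_orbitMap hg) (by
      refine continuous_if (fun x hx => ?_) ?_ continuous_const.continuousOn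
      · have h := (PadicInt.isClopen_dvd_pow (p := p) k).preimage
          (continuous_fst : Continuous (Prod.fst : ℤ_[p] × lowerTriangular p → ℤ_[p]))
        have h2 := h.frontier_eq
        rw [show {x : ℤ_[p] × lowerTriangular p | (p : ℤ_[p]) ^ k ∣ x.1} =
          Prod.fst ⁻¹' {z : ℤ_[p] | (p : ℤ_[p]) ^ k ∣ z} from rfl, h2] at hx
        exact hx.elim
      · exact ((Units.continuous_val.comp ψ.continuous_toFun).comp continuous_snd).continuousOn)⟩

variable {ψ}

open Classical in
theorem orbitFun_apply {g : GL (Fin 2) ℤ_[p]} (hg : g 0 1 ≠ 0) (k : ℕ) (z : ℤ_[p])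
    (b : lowerTriangular p) :
    orbitFun ψ hg k (lowerUnipotent p z * g * b.1) =
      if (p : ℤ_[p]) ^ k ∣ z then ((ψ b : Rˣ) : R) else 0 :=
  (orbitMap_injective hg).extend_apply
    (fun x => if (p : ℤ_[p]) ^ k ∣ x.1 then ((ψ x.2 : Rˣ) : R) else 0) 0 (z, b)

open Classical in
theorem orbitFun_of_notMem {g : GL (Fin 2) ℤ_[p]} (hg : g 0 1 ≠ 0) (k : ℕ)
    {x : GL (Fin 2) ℤ_[p]} (hx : x ∉ Set.range (orbitMap g)) : orbitFun ψ hg k x = 0 :=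
  Function.extend_apply' (fun x : ℤ_[p] × lowerTriangular p =>
    if (p : ℤ_[p]) ^ k ∣ x.1 then ((ψ x.2 : Rˣ) : R) else 0) (0 : GL (Fin 2) ℤ_[p] → R) x hx

theorem lowerUnipotent_mul_mem_range {g x : GL (Fin 2) ℤ_[p]} {z : ℤ_[p]} :
    lowerUnipotent p z * x ∈ Set.range (orbitMap g) ↔ x ∈ Set.range (orbitMap g) := by
  have key : ∀ (z : ℤ_[p]) (x : GL (Fin 2) ℤ_[p]), x ∈ Set.range (orbitMap g) →
      lowerUnipotent p z * x ∈ Set.range (orbitMap g) := by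
    rintro z x ⟨⟨w, b⟩, rfl⟩
    exact ⟨(z + w, b), by simp only [orbitMap, lowerUnipotent_add, mul_assoc]⟩
  refine ⟨fun h => ?_, key z x⟩
  have := key (-z) _ h
  rwa [lowerUnipotent_neg, inv_mul_cancel_left] at this

theorem mem_range_orbitMap_translate {g x : GL (Fin 2) ℤ_[p]} {z : ℤ_[p]} :
    x ∈ Set.range (orbitMap (lowerUnipotent p z * g)) ↔ x ∈ Set.range (orbitMap g) := by
  have key : ∀ (z : ℤ_[p]) (g x : GL (Fin 2) ℤ_[p]),
      x ∈ Set.range (orbitMap (lowerUnipotent p z * g)) → x ∈ Set.range (orbitMap g) := by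
    rintro z g x ⟨⟨w, b⟩, rfl⟩
    exact ⟨(w + z, b), by simp only [orbitMap, lowerUnipotent_add, mul_assoc]⟩
  refine ⟨key z g x, fun h => key (-z) _ x ?_⟩
  rwa [lowerUnipotent_neg, inv_mul_cancel_left]

theorem orbitFun_mul {g : GL (Fin 2) ℤ_[p]} (hg : g 0 1 ≠ 0) (k : ℕ) (x : GL (Fin 2) ℤ_[p])
    (b : lowerTriangular p) : orbitFun ψ hg k (x * b.1) = orbitFun ψ hg k x * (ψ b : R) := by
  classical
  have key : ∀ (x : GL (Fin 2) ℤ_[p]) (b : lowerTriangular p), x ∈ Set.range (orbitMap g) →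
      x * b.1 ∈ Set.range (orbitMap g) := by
    rintro _ b ⟨⟨z, c⟩, rfl⟩
    exact ⟨(z, c * b), by simp only [orbitMap, Subgroup.coe_mul, mul_assoc]⟩
  by_cases hx : x ∈ Set.range (orbitMap g)
  · obtain ⟨⟨z, c⟩, rfl⟩ := hx
    rw [orbitMap, orbitFun_apply, mul_assoc, ← Subgroup.coe_mul, orbitFun_apply]
    split_ifs <;> simp
  · rw [orbitFun_of_notMem hg k hx, orbitFun_of_notMem hg k, zero_mul]
    intro h
    have := key _ b⁻¹ h
    rw [Subgroup.coe_inv, mul_inv_cancel_right] at this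
    exact hx this

theorem lowerUnipotent_mul_ne_zero {g : GL (Fin 2) ℤ_[p]} (hg : g 0 1 ≠ 0) (z : ℤ_[p]) :
    (lowerUnipotent p z * g) 0 1 ≠ 0 := by
  rwa [lowerUnipotent_mul_apply_zero]

/-- Changing the base point within an `N`-orbit amounts to translating by `N`; invariant measures
thus give equal mass to balls of equal radius in one orbit. -/
theorem leftTranslate_orbitFun {g : GL (Fin 2) ℤ_[p]} (hg : g 0 1 ≠ 0) (k : ℕ) (z : ℤ_[p]) :
    leftTranslate (lowerUnipotent p z) (orbitFun ψ (lowerUnipotent_mul_ne_zero hg z) k) =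
      orbitFun ψ hg k := by
  classical
  ext x
  change orbitFun ψ (lowerUnipotent_mul_ne_zero hg z) k (lowerUnipotent p z * x) = _
  by_cases hx : x ∈ Set.range (orbitMap g)
  · obtain ⟨⟨w, b⟩, rfl⟩ := hx
    have : lowerUnipotent p z * orbitMap g (w, b) =
        lowerUnipotent p w * (lowerUnipotent p z * g) * b.1 := by
      simp only [orbitMap, ← mul_assoc, ← lowerUnipotent_add, add_comm]
    rw [this, orbitFun_apply, orbitMap, orbitFun_apply]
  · rw [orbitFun_of_notMem hg k hx, orbitFun_of_notMem]
    rwa [mem_range_orbitMap_translate, lowerUnipotent_mul_mem_range]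

theorem PadicInt.exists_unique_digit (k : ℕ) {z : ℤ_[p]} (hz : (p : ℤ_[p]) ^ k ∣ z) :
    ∃ i ∈ Finset.range p, ∀ j ∈ Finset.range p,
      (p : ℤ_[p]) ^ (k + 1) ∣ z - p ^ k * j ↔ j = i := by
  obtain ⟨w, rfl⟩ := hz
  have hp0 : (p : ℤ_[p]) ^ k ≠ 0 := pow_ne_zero _ (mod_cast (Fact.out : p.Prime).ne_zero)
  have h1 : ∀ j : ℕ, (p : ℤ_[p]) ^ (k + 1) ∣ p ^ k * w - p ^ k * j ↔
      PadicInt.toZMod w = (j : ZMod p) := by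
    intro j
    rw [pow_succ, ← mul_sub, mul_dvd_mul_iff_left hp0, ← Ideal.mem_span_singleton,
      ← PadicInt.maximalIdeal_eq_span_p, ← PadicInt.ker_toZMod, RingHom.mem_ker, map_sub,
      sub_eq_zero, map_natCast]
  refine ⟨(PadicInt.toZMod w).val, Finset.mem_range.2 (ZMod.val_lt _), fun j hj => ?_⟩
  rw [h1]
  constructor
  · intro h
    rw [h, ZMod.val_natCast_of_lt (Finset.mem_range.1 hj)]
  · rintro rfl
    exact (ZMod.natCast_zmod_val _).symm

/-- The splitting of `p ^ k ℤ_p` into `p` cosets of `p ^ (k+1) ℤ_p`, transported to the orbit. -/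
theorem orbitFun_eq_sum {g : GL (Fin 2) ℤ_[p]} (hg : g 0 1 ≠ 0) (k : ℕ) (x : GL (Fin 2) ℤ_[p]) :
    orbitFun ψ hg k x = ∑ j ∈ Finset.range p,
      orbitFun ψ (lowerUnipotent_mul_ne_zero hg (p ^ k * (j : ℤ_[p]))) (k + 1) x := by
  classical
  by_cases hx : x ∈ Set.range (orbitMap g)
  · obtain ⟨⟨z, b⟩, rfl⟩ := hx
    have h : ∀ j : ℕ, orbitFun ψ (lowerUnipotent_mul_ne_zero hg (p ^ k * (j : ℤ_[p]))) (k + 1)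
        (orbitMap g (z, b)) =
        if (p : ℤ_[p]) ^ (k + 1) ∣ z - p ^ k * j then ((ψ b : Rˣ) : R) else 0 := by
      intro j
      rw [← orbitFun_apply (lowerUnipotent_mul_ne_zero hg (p ^ k * (j : ℤ_[p]))) (k + 1)]
      congr 1
      rw [orbitMap, ← mul_assoc (lowerUnipotent p _), ← lowerUnipotent_add, sub_add_cancel]
    simp only [h]
    rw [orbitMap, orbitFun_apply]
    split_ifs with hz
    · obtain ⟨i, hi, hij⟩ := PadicInt.exists_unique_digit k hz
      rw [Finset.sum_eq_single_of_mem i hi fun j hj hne => if_neg fun h => hne ((hij j hj).1 h),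
        if_pos ((hij i hi).2 rfl)]
    · refine (Finset.sum_eq_zero fun j _ => if_neg fun h => hz ?_).symm
      have := (((pow_dvd_pow _ (Nat.le_succ k)).trans h).add (dvd_mul_right _ (j : ℤ_[p])))
      simpa using this
  · rw [orbitFun_of_notMem hg k hx]
    refine (Finset.sum_eq_zero fun j _ => orbitFun_of_notMem _ _ ?_).symm
    rwa [mem_range_orbitMap_translate]

variable [IsTopologicalRing R] (I : Ideal R) (hI : ∀ n : ℕ, IsOpen ((I ^ n : Ideal R) : Set R)) [IsAdicComplete I R]

/-- A bounded measure on an orbit of the unipotent group which is invariant under this group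
vanishes. -/
theorem integral_orbitFun_eq_zero (hp : (p : R) ∈ I)
    (a : CompletedGroupAlgebra R (GL (Fin 2) ℤ_[p]))
    (ha : ∀ (φ : C(GL (Fin 2) ℤ_[p], R)), (∀ x (b : lowerTriangular p), φ (x * b.1) = φ x * ψ b) →
      ∀ z, integral I hI (leftTranslate (lowerUnipotent p z) φ) a = integral I hI φ a)
    {g : GL (Fin 2) ℤ_[p]} (hg : g 0 1 ≠ 0) (k : ℕ) : integral I hI (orbitFun ψ hg k) a = 0 := by
  have h1 : ∀ k, integral I hI (orbitFun ψ hg k) a =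
      p * integral I hI (orbitFun ψ hg (k + 1)) a := by
    intro k
    rw [integral_sum I hI _ _ _ (orbitFun_eq_sum hg k)]
    have : ∀ z, integral I hI (orbitFun ψ (lowerUnipotent_mul_ne_zero hg z) (k + 1)) a =
        integral I hI (orbitFun ψ hg (k + 1)) a := by
      intro z
      rw [← leftTranslate_orbitFun hg (k + 1) z]
      exact (ha _ (orbitFun_mul _ _) z).symm
    simp [this]
  have h2 : ∀ r, integral I hI (orbitFun ψ hg k) a =
      p ^ r * integral I hI (orbitFun ψ hg (k + r)) a := by
    intro r
    induction r with
    | zero => simp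
    | succ r ih => rw [ih, h1, pow_succ, mul_assoc, add_assoc]
  -- Boundedness enters here: the cofactors of `p ^ r` are integral, so the value lies in every `I ^
  -- n`.
  refine eq_of_forall_sub_mem_pow I fun n => ?_
  rw [sub_zero, h2 n]
  exact (I ^ n).mul_mem_right _ (Ideal.pow_mem_pow hp n)

end OrbitFunctions

end

noncomputable section

/-! ### Measures supported at the base point -/

section GeneratingRelations

variable {R : Type*} [CommRing R] {G : Type*} [Group G] [TopologicalSpace G]

theorem of_mul_sub_algebraMap_mul (g h : G) (r s : R) :
    CompletedGroupAlgebra.of R (g * h) - algebraMap R (CompletedGroupAlgebra R G) (r * s) =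
      CompletedGroupAlgebra.of R g * (CompletedGroupAlgebra.of R h - algebraMap R _ s) +
        algebraMap R _ s * (CompletedGroupAlgebra.of R g - algebraMap R _ r) := by
  rw [map_mul, map_mul, mul_sub, mul_sub, Algebra.commutes s (CompletedGroupAlgebra.of R g),
    Algebra.commutes s (algebraMap R (CompletedGroupAlgebra R G) r)]
  abel

variable [TopologicalSpace R] {G' : Type*} [Group G'] [TopologicalSpace G']
  (f : G' →ₜ* G) (ψ : G' →ₜ* Rˣ)

/-- The element `[f(b)] - ψ(b)` of `R[[G]]`. -/
def characterRelation (b : G') : CompletedGroupAlgebra R G :=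
  CompletedGroupAlgebra.of R (f b) - algebraMap R _ (ψ b : R)

/-- A twisted cocycle identity: the `b` whose relation lies in a given left ideal are closed under
products. -/
theorem characterRelation_mul (b c : G') :
    characterRelation f ψ (b * c) = CompletedGroupAlgebra.of R (f b) * characterRelation f ψ c +
      algebraMap R _ (ψ c : R) * characterRelation f ψ b := by
  rw [characterRelation, map_mul f, map_mul ψ, Units.val_mul, of_mul_sub_algebraMap_mul]
  rfl

theorem of_eq_characterRelation_add (b : G') :
    CompletedGroupAlgebra.of R (f b) = characterRelation f ψ b +
      (ψ b : R) • (1 : CompletedGroupAlgebra R G) := by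
  rw [characterRelation, ← Algebra.algebraMap_eq_smul_one (A := CompletedGroupAlgebra R G)]
  exact (sub_add_cancel _ _).symm

theorem of_mul_eq_add (g : G) (b : G') :
    CompletedGroupAlgebra.of R (g * f b) = CompletedGroupAlgebra.of R g * characterRelation f ψ b +
      (ψ b : R) • CompletedGroupAlgebra.of R g := by
  rw [map_mul, of_eq_characterRelation_add f ψ b, mul_add, mul_smul_comm, mul_one]

theorem characterRelation_one : characterRelation f ψ 1 = 0 := by
  simp [characterRelation]

variable [IsTopologicalRing R] [T2Space R] [CompactSpace R] [IsTopologicalGroup G] [CompactSpace G]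

/-- The left ideal generated by `[f(b)] - ψ(b)` for `b` in a set of topological generators contains
all these elements. -/
theorem characterRelation_mem_span (S : Finset G')
    (hS : ∀ C : Subgroup G', IsClosed (C : Set G') → (∀ s ∈ S, s ∈ C) → C = ⊤) (b : G') :
    characterRelation f ψ b ∈ Submodule.span (CompletedGroupAlgebra R G)
      (Set.range fun s : S => characterRelation f ψ s.1) := by
  set J := Submodule.span (CompletedGroupAlgebra R G)
    (Set.range fun s : S => characterRelation f ψ s.1)
  let C : Subgroup G' :=
    { carrier := {b | characterRelation f ψ b ∈ J}
      one_mem' := by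
        change characterRelation f ψ 1 ∈ J
        rw [characterRelation_one]
        exact J.zero_mem
      mul_mem' := fun {b c} hb hc => by
        change characterRelation f ψ (b * c) ∈ J
        rw [characterRelation_mul]
        exact J.add_mem (J.smul_mem _ hc) (J.smul_mem _ hb)
      inv_mem' := fun {b} hb => by
        change characterRelation f ψ b⁻¹ ∈ J
        -- The identity for `b⁻¹ * b = 1` yields the relation of `b⁻¹` up to the unit `ψ b`.
        have h := characterRelation_mul f ψ b⁻¹ b
        rw [inv_mul_cancel, characterRelation_one] at h
        have h1 : algebraMap R (CompletedGroupAlgebra R G) (ψ b : R) *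
            characterRelation f ψ b⁻¹ ∈ J := by
          rw [← neg_eq_of_add_eq_zero_right h.symm]
          exact J.neg_mem (J.smul_mem _ hb)
        have h2 := J.smul_mem (algebraMap R (CompletedGroupAlgebra R G) ((ψ b)⁻¹ : Rˣ)) h1
        rwa [smul_eq_mul, ← mul_assoc, ← map_mul, Units.inv_mul, map_one, one_mul] at h2 }
  have hC : IsClosed (C : Set G') := by
    have hc : Continuous fun b => characterRelation f ψ b := by
      have : (fun b => characterRelation f ψ b) = fun b =>
          CompletedGroupAlgebra.of R (f b) + algebraMap R _ (-(ψ b : R)) := by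
        funext b
        rw [characterRelation, map_neg, sub_eq_add_neg]
      rw [this]
      exact (CompletedGroupAlgebra.continuous_of.comp f.continuous_toFun).add
        (CompletedGroupAlgebra.continuous_algebraMap.comp
          (Units.continuous_val.comp ψ.continuous_toFun).neg)
    exact (isClosed_leftSpan fun s : S => characterRelation f ψ s.1).preimage hc
  have hT := hS C hC fun s hs => Submodule.subset_span ⟨⟨s, hs⟩, rfl⟩
  exact (Subgroup.eq_top_iff' C).1 hT b

end GeneratingRelations

/-! ### Finite-level expansions -/

section LevelSums

theorem sum_smul_sub_sum_smul_add {R M α β : Type*} [CommRing R] [AddCommGroup M] [Module R M]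
    (s : Finset α) (t : Finset β) (A : α → R) (Y : α → M) (F : β → α → R) (v : β → M) :
    ∑ q ∈ s, A q • Y q - ∑ q ∈ s, A q • (Y q + ∑ c ∈ t, F c q • v c) =
      -∑ c ∈ t, (∑ q ∈ s, A q * F c q) • v c := by
  simp only [smul_add, Finset.sum_add_distrib, Finset.smul_sum, Finset.sum_smul, smul_smul]
  rw [Finset.sum_comm]
  abel

variable {R : Type*} [CommRing R] {G : Type*} [Group G] [TopologicalSpace G]

theorem levelSum_eq_sum (φ : G → R) (H : OpenNormalSubgroup G) [Fintype (G ⧸ H.toSubgroup)]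
    (x : MonoidAlgebra R (G ⧸ H.toSubgroup)) :
    levelSum φ H x = ∑ q, x.coeff q * φ q.out := by
  change Finsupp.linearCombination R _ x.coeff = _
  rw [Finsupp.linearCombination_apply, Finsupp.sum_fintype _ _ (by simp)]
  simp

theorem proj_eq_sum_coeff {H H' : OpenNormalSubgroup G} (h : H' ≤ H)
    [Fintype (G ⧸ H'.toSubgroup)] (a : CompletedGroupAlgebra R G) :
    CompletedGroupAlgebra.proj R H a = ∑ q, (CompletedGroupAlgebra.proj R H' a).coeff q •
      CompletedGroupAlgebra.proj R H (CompletedGroupAlgebra.of R q.out) := by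
  have h1 : CompletedGroupAlgebra.proj R H' a =
      ∑ q : G ⧸ H'.toSubgroup, (CompletedGroupAlgebra.proj R H' a).coeff q •
        CompletedGroupAlgebra.proj R H' (CompletedGroupAlgebra.of R q.out) := by
    refine MonoidAlgebra.coeff_injective (Finsupp.ext fun q => ?_)
    classical
    simp [CompletedGroupAlgebra.proj_of]
  rw [← CompletedGroupAlgebra.transition_proj R h, h1, map_sum]
  refine Finset.sum_congr rfl fun q _ => ?_
  rw [map_smul, CompletedGroupAlgebra.transition_proj, ← h1]

theorem proj_of_mul_left {H : OpenNormalSubgroup (G)} {h : G}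
    (hh : h ∈ H) (x : G) :
    CompletedGroupAlgebra.proj R H (CompletedGroupAlgebra.of R (h * x)) =
      CompletedGroupAlgebra.proj R H (CompletedGroupAlgebra.of R x) := by
  rw [CompletedGroupAlgebra.proj_of, CompletedGroupAlgebra.proj_of]
  congr 1
  rw [QuotientGroup.mk_mul, (QuotientGroup.eq_one_iff h).2 hh, one_mul]

end LevelSums

/-! ### Double cosets away from `P` and the support argument -/

section Support

variable {p : ℕ} [Fact p.Prime]

theorem exists_lowerUnipotent_mem (H : OpenNormalSubgroup (GL (Fin 2) ℤ_[p])) :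
    ∃ k : ℕ, ∀ z : ℤ_[p], (p : ℤ_[p]) ^ k ∣ z → lowerUnipotent p z ∈ H := by
  have ho : IsOpen (lowerUnipotent p ⁻¹' (H : Set (GL (Fin 2) ℤ_[p]))) :=
    H.isOpen'.preimage (continuous_lowerUnipotent p)
  have h0 : (0 : ℤ_[p]) ∈ lowerUnipotent p ⁻¹' (H : Set (GL (Fin 2) ℤ_[p])) := by
    rw [Set.mem_preimage, lowerUnipotent_zero]
    exact one_mem H
  obtain ⟨ε, hε, hb⟩ := Metric.isOpen_iff.1 ho 0 h0
  obtain ⟨k, hk⟩ := PadicInt.exists_pow_neg_lt p hε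
  refine ⟨k, fun z hz => hb ?_⟩
  rw [mem_ball_zero_iff]
  exact ((PadicInt.norm_le_pow_iff_mem_span_pow z k).2 (Ideal.mem_span_singleton.2 hz)).trans_lt hk

/-- The equivalence relation whose classes are the double cosets of `{n(z) : p ^ k ∣ z}` and `P`. -/
def doubleCosetSetoid (p : ℕ) [Fact p.Prime] (k : ℕ) : Setoid (GL (Fin 2) ℤ_[p]) where
  r x y := ∃ (z : ℤ_[p]) (b : lowerTriangular p), (p : ℤ_[p]) ^ k ∣ z ∧
    y = lowerUnipotent p z * x * b.1
  iseqv :=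
    { refl := fun x => ⟨0, 1, dvd_zero _, by simp [lowerUnipotent_zero]⟩
      symm := by
        rintro x _ ⟨z, b, hz, rfl⟩
        refine ⟨-z, b⁻¹, hz.neg_right, ?_⟩
        rw [lowerUnipotent_neg, Subgroup.coe_inv]
        group
      trans := by
        rintro x _ _ ⟨z, b, hz, rfl⟩ ⟨w, c, hw, rfl⟩
        refine ⟨w + z, b * c, hw.add hz, ?_⟩
        rw [lowerUnipotent_add, Subgroup.coe_mul]
        group }

theorem isOpen_doubleCoset {g : GL (Fin 2) ℤ_[p]} (hg : g 0 1 ≠ 0) (k : ℕ) :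
    IsOpen {x | (doubleCosetSetoid p k).r g x} := by
  have : {x | (doubleCosetSetoid p k).r g x} = orbitMap g '' (Prod.fst ⁻¹' {z | (p : ℤ_[p]) ^ k ∣ z}) := by
    ext x
    constructor
    · rintro ⟨z, b, hz, rfl⟩
      exact ⟨(z, b), hz, rfl⟩
    · rintro ⟨⟨z, b⟩, hz, rfl⟩
      exact ⟨z, b, hz, rfl⟩
  rw [this]
  exact (Topology.IsOpenEmbedding.isOpenMap
    ⟨(isClosedEmbedding_orbitMap hg).isEmbedding, isOpen_range_orbitMap hg⟩) _
    ((PadicInt.isClopen_dvd_pow k).isOpen.preimage continuous_fst)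

-- Under `hk` the open set `H * P` is a union of double cosets. Its complement is compact and misses
-- `P`, so finitely many of the open double cosets cover it.
open scoped Pointwise in
theorem exists_finset_doubleCosets (H : OpenNormalSubgroup (GL (Fin 2) ℤ_[p])) {k : ℕ}
    (hk : ∀ z : ℤ_[p], (p : ℤ_[p]) ^ k ∣ z → lowerUnipotent p z ∈ H) :
    ∃ T : Finset (Quotient (doubleCosetSetoid p k)),
      ∀ x, (Quotient.mk (doubleCosetSetoid p k) x ∈ T ↔
        x ∉ (H : Set (GL (Fin 2) ℤ_[p])) * (lowerTriangular p : Set (GL (Fin 2) ℤ_[p]))) := by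
  classical
  set U := (H : Set (GL (Fin 2) ℤ_[p])) * (lowerTriangular p : Set (GL (Fin 2) ℤ_[p]))
  have hU : IsOpen U := IsOpen.mul_right H.isOpen'
  have hP : ∀ x ∉ U, x 0 1 ≠ 0 := fun x hx h =>
    hx ⟨1, one_mem H, x, h, one_mul x⟩
  have hstab : ∀ x y, (doubleCosetSetoid p k).r x y → x ∈ U → y ∈ U := by
    rintro _ _ ⟨z, b, hz, rfl⟩ ⟨h, hh, c, hc, rfl⟩
    exact ⟨lowerUnipotent p z * h, mul_mem (hk z hz) hh, c * b.1, mul_mem hc b.2, by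
      simp only [mul_assoc]⟩
  obtain ⟨t, ht⟩ := hU.isClosed_compl.isCompact.elim_finite_subcover
    (fun g : {x // x ∉ U} => {x | (doubleCosetSetoid p k).r g.1 x})
    (fun g => isOpen_doubleCoset (hP g.1 g.2) k)
    (fun x hx => Set.mem_iUnion.2 ⟨⟨x, hx⟩, (doubleCosetSetoid p k).refl x⟩)
  refine ⟨t.image fun g => Quotient.mk _ g.1, fun x => ⟨fun hx hxU => ?_, fun hx => ?_⟩⟩
  · obtain ⟨g, _, hg⟩ := Finset.mem_image.1 hx
    exact g.2 (hstab _ _ ((doubleCosetSetoid p k).symm (Quotient.exact hg)) hxU)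
  · obtain ⟨g, hg, hgx⟩ := Set.mem_iUnion₂.1 (ht hx)
    exact Finset.mem_image.2 ⟨g, hg, Quotient.sound hgx⟩

variable {R : Type*} [CommRing R] [TopologicalSpace R] [IsTopologicalRing R]
  (ψ : lowerTriangular p →ₜ* Rˣ)

open Classical in
/-- The function `orbitFun` attached to the chosen representative of a double coset. -/
def doubleCosetFun {k : ℕ} (c : Quotient (doubleCosetSetoid p k)) : C(GL (Fin 2) ℤ_[p], R) :=
  if h : c.out 0 1 ≠ 0 then orbitFun ψ h k else 0

variable {ψ}

omit [IsTopologicalRing R] in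
theorem doubleCosetFun_of_ne {k : ℕ} {c : Quotient (doubleCosetSetoid p k)}
    {x : GL (Fin 2) ℤ_[p]} (h : Quotient.mk _ x ≠ c) : doubleCosetFun ψ c x = 0 := by
  rw [doubleCosetFun]
  split_ifs with hc
  · by_cases hx : x ∈ Set.range (orbitMap c.out)
    · obtain ⟨⟨z, b⟩, rfl⟩ := hx
      rw [orbitMap, orbitFun_apply, if_neg]
      intro hz
      refine h ?_
      exact (Quotient.sound (s := doubleCosetSetoid p k) ⟨z, b, hz, rfl⟩).symm.trans c.out_eq
    · exact orbitFun_of_notMem _ _ hx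
  · rfl

omit [IsTopologicalRing R] in
theorem doubleCosetFun_apply {k : ℕ} {c : Quotient (doubleCosetSetoid p k)} (hc : c.out 0 1 ≠ 0)
    {z : ℤ_[p]} (hz : (p : ℤ_[p]) ^ k ∣ z) (b : lowerTriangular p) :
    doubleCosetFun ψ c (lowerUnipotent p z * c.out * b.1) = ψ b := by
  rw [doubleCosetFun, dif_pos hc, orbitFun_apply, if_pos hz]

variable [T2Space R] [CompactSpace R] (I : Ideal R) (hI : IsAdic I) [IsAdicComplete I R]

open scoped Pointwise in
/-- Modulo `H`, each group element is congruent, up to the relations and scalars, to its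
expansion in the representatives of the double cosets. -/
theorem exists_proj_of_eq_add_sum (S : Finset (lowerTriangular p))
    (hS : ∀ C : Subgroup (lowerTriangular p), IsClosed (C : Set (lowerTriangular p)) →
      (∀ s ∈ S, s ∈ C) → C = ⊤)
    {H : OpenNormalSubgroup (GL (Fin 2) ℤ_[p])} {k : ℕ}
    (hk : ∀ z : ℤ_[p], (p : ℤ_[p]) ^ k ∣ z → lowerUnipotent p z ∈ H)
    {T : Finset (Quotient (doubleCosetSetoid p k))}
    (hT : ∀ x, (Quotient.mk (doubleCosetSetoid p k) x ∈ T ↔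
      x ∉ (H : Set (GL (Fin 2) ℤ_[p])) * (lowerTriangular p : Set (GL (Fin 2) ℤ_[p]))))
    (hout : ∀ c ∈ T, c.out 0 1 ≠ 0) (x : GL (Fin 2) ℤ_[p]) :
    ∃ y ∈ scalarsSupLeftSpan
      (fun s : S => characterRelation (lowerTriangularInclusion p) ψ s.1),
      CompletedGroupAlgebra.proj R H (CompletedGroupAlgebra.of R x) =
      CompletedGroupAlgebra.proj R H y + ∑ c ∈ T, doubleCosetFun ψ c x •
        CompletedGroupAlgebra.proj R H (CompletedGroupAlgebra.of R c.out) := by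
  have hrel : ∀ b : lowerTriangular p, characterRelation (lowerTriangularInclusion p) ψ b ∈
      Submodule.span (CompletedGroupAlgebra R (GL (Fin 2) ℤ_[p]))
        (Set.range fun s : S => characterRelation (lowerTriangularInclusion p) ψ s.1) :=
    characterRelation_mem_span (lowerTriangularInclusion p) ψ S hS
  by_cases hx : Quotient.mk (doubleCosetSetoid p k) x ∈ T
  -- Here `x = n(z) c b`. The factor `n(z) ∈ H` is invisible at level `H`, and `[c b] = [c]([b] -
  -- ψ(b)) + ψ(b)[c]`.
  · obtain ⟨z, b, hz, hxb⟩ := Quotient.mk_out (s := doubleCosetSetoid p k) x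
    set c := Quotient.mk (doubleCosetSetoid p k) x
    refine ⟨CompletedGroupAlgebra.of R c.out *
      characterRelation (lowerTriangularInclusion p) ψ b,
      mem_scalarsSupLeftSpan_of_mem_span (Submodule.smul_mem _ _ (hrel b)), ?_⟩
    rw [Finset.sum_eq_single_of_mem c hx fun c' _ hc' => by
      rw [doubleCosetFun_of_ne hc'.symm, zero_smul], hxb, doubleCosetFun_apply (hout c hx) hz,
      mul_assoc, proj_of_mul_left (hk z hz), ← map_smul, ← map_add]
    exact congrArg _ (of_mul_eq_add (lowerTriangularInclusion p) ψ c.out b)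
  -- Here `x = h b` with `h ∈ H`, so `[x]` becomes `[b] = ([b] - ψ(b)) + ψ(b)`, and no double coset
  -- in `T` contributes.
  · have hxU := not_not.1 (mt (hT x).2 hx)
    obtain ⟨h, hh, b, hb, rfl⟩ := hxU
    refine ⟨CompletedGroupAlgebra.of R b, ?_, ?_⟩
    · rw [show CompletedGroupAlgebra.of R b = _ from
        of_eq_characterRelation_add (lowerTriangularInclusion p) ψ ⟨b, hb⟩]
      exact Submodule.add_mem _ (mem_scalarsSupLeftSpan_of_mem_span (hrel _))
        (smul_one_mem_scalarsSupLeftSpan _ _)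
    · rw [Finset.sum_eq_zero fun c hc => by
        rw [doubleCosetFun_of_ne fun hc' => hx (hc' ▸ hc), zero_smul], add_zero]
      exact proj_of_mul_left hh b

/-- An element of `R[[G]]` whose integrals against all equivariant functions supported away from
`P` vanish is a scalar modulo the relations defining the induced module. -/
theorem mem_scalarsSupLeftSpan_of_integral_eq_zero (S : Finset (lowerTriangular p))
    (hS : ∀ C : Subgroup (lowerTriangular p), IsClosed (C : Set (lowerTriangular p)) →
      (∀ s ∈ S, s ∈ C) → C = ⊤)
    (a : CompletedGroupAlgebra R (GL (Fin 2) ℤ_[p]))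
    (ha : ∀ (g : GL (Fin 2) ℤ_[p]) (hg : g 0 1 ≠ 0) (k : ℕ),
      integral I (isAdic_iff.1 hI).1 (orbitFun ψ hg k) a = 0) :
    a ∈ scalarsSupLeftSpan
      (fun s : S => characterRelation (lowerTriangularInclusion p) ψ s.1) := by
  refine mem_scalarsSupLeftSpan_of_approx hI _ a fun H m => ?_
  set Λ := scalarsSupLeftSpan (fun s : S => characterRelation (lowerTriangularInclusion p) ψ s.1)
  obtain ⟨k, hk⟩ := exists_lowerUnipotent_mem H
  obtain ⟨T, hT⟩ := exists_finset_doubleCosets H hk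
  have hout : ∀ c ∈ T, c.out 0 1 ≠ 0 := by
    intro c hc h
    rw [← c.out_eq] at hc
    exact (hT _).1 hc ⟨1, one_mem H, c.out, h, one_mul _⟩
  choose y hyΛ hy using exists_proj_of_eq_add_sum (R := R) (ψ := ψ) S hS hk hT hout
  choose L hL using fun c : Quotient (doubleCosetSetoid p k) =>
    exists_isLevel ((isAdic_iff.1 hI).1 m) (doubleCosetFun ψ c)
  obtain ⟨H', hH', hlev⟩ := exists_le_forall_le L H T
  have := Fintype.ofFinite (GL (Fin 2) ℤ_[p] ⧸ H'.toSubgroup)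
  -- The approximant replaces each `[q.out]` in the level-`H'` expansion of `a` by its part in the
  -- span.
  refine ⟨∑ q : GL (Fin 2) ℤ_[p] ⧸ H'.toSubgroup,
    (CompletedGroupAlgebra.proj R H' a).coeff q • y q.out,
    Λ.sum_mem fun q _ => Λ.smul_mem _ (hyΛ _), ?_⟩
  -- The coefficients of the error are Riemann sums of the double coset functions, congruent modulo
  -- `I ^ m` to integrals that vanish by `ha`.
  have e : CompletedGroupAlgebra.proj R H (∑ q : GL (Fin 2) ℤ_[p] ⧸ H'.toSubgroup,
      (CompletedGroupAlgebra.proj R H' a).coeff q • y q.out - a) =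
      -∑ c ∈ T, levelSum (doubleCosetFun ψ c) H' (CompletedGroupAlgebra.proj R H' a) •
        CompletedGroupAlgebra.proj R H (CompletedGroupAlgebra.of R c.out) := by
    rw [map_sub, proj_eq_sum_coeff hH' a, map_sum (CompletedGroupAlgebra.proj R H)]
    simp only [levelSum_eq_sum]
    rw [← sum_smul_sub_sum_smul_add Finset.univ T _
      (fun q => CompletedGroupAlgebra.proj R H (y q.out))]
    congr 1
    exact Finset.sum_congr rfl fun q _ => congrArg _ (hy q.out)
  rw [e]
  refine Submodule.neg_mem _ (Submodule.sum_mem _ fun c hc => ?_)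
  refine Submodule.smul_mem_smul ?_ trivial
  have h1 := ((hL c).mono (hlev c hc)).integral_sub_mem I (isAdic_iff.1 hI).1 a
  rw [doubleCosetFun, dif_pos (hout c hc), ha, zero_sub, neg_mem_iff] at h1
  rw [doubleCosetFun, dif_pos (hout c hc)]
  exact h1

end Support

end

noncomputable section

/-! ### Homomorphisms between the induced modules -/

section Cyclic

variable {k A : Type*} [Field k] [Ring A] [Algebra k A]

theorem smul_smul_one_add_sub_algebraMap (c r : k) (x : A) :
    c • (r • 1 + x) - algebraMap k A (c * r) = algebraMap k A c • x := by
  rw [smul_add, smul_smul, ← Algebra.algebraMap_eq_smul_one, add_sub_cancel_left, smul_eq_mul,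
    Algebra.smul_def]

theorem mul_mem_ker_toSpanSingleton {M M' : Type*} [AddCommGroup M] [Module A M]
    [AddCommGroup M'] [Module A M'] (f : M' →ₗ[A] M) {e : M} {e' : M'} {α x : A}
    (hα : f e' = α • e) (hx : x • e' = 0) :
    x * α ∈ LinearMap.ker (LinearMap.toSpanSingleton A M e) := by
  rw [LinearMap.mem_ker, LinearMap.toSpanSingleton_apply, mul_smul, ← hα, ← map_smul, hx,
    map_zero]

theorem smul_eq_smul_of_sub_mem_ker {M : Type*} [AddCommGroup M] [Module A M] {e : M} {x y : A}
    (h : x - y ∈ LinearMap.ker (LinearMap.toSpanSingleton A M e)) : x • e = y • e := by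
  rw [LinearMap.mem_ker, LinearMap.toSpanSingleton_apply, sub_smul] at h
  exact sub_eq_zero.1 h

/-- The vector `f e' = c • e` has eigenvalue `r'` under `x` by linearity of `f` and `r` because
scalars are central, so it is zero. -/
theorem hom_eq_zero_of_eigenvalue_ne {M M' : Type*} [AddCommGroup M] [Module A M]
    [AddCommGroup M'] [Module A M'] {e : M} {e' : M'} (he' : ∀ m : M', ∃ α : A, m = α • e')
    {x : A} {r r' : k} (hr : r ≠ r') (hx : (x - algebraMap k A r) • e = 0)
    (hx' : (x - algebraMap k A r') • e' = 0) (f : M' →ₗ[A] M)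
    (hf : ∃ c : k, f e' = algebraMap k A c • e) : f = 0 := by
  obtain ⟨c, hc⟩ := hf
  have h1 : (x - algebraMap k A r) • f e' = 0 := by
    rw [hc, ← mul_smul, ← Algebra.commutes, mul_smul, hx, smul_zero]
  have h2 : (x - algebraMap k A r') • f e' = 0 := by rw [← map_smul, hx', map_zero]
  have h3 : algebraMap k A (r - r') • f e' = 0 := by
    have h : algebraMap k A (r - r') =
        (x - algebraMap k A r') - (x - algebraMap k A r) := by
      rw [map_sub]
      abel
    rw [h, sub_smul, h1, h2, sub_zero]
  have h4 : f e' = 0 := by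
    have h5 : algebraMap k A (r - r')⁻¹ • algebraMap k A (r - r') • f e' = 0 := by
      rw [h3, smul_zero]
    rwa [← mul_smul, ← map_mul, inv_mul_cancel₀ (sub_ne_zero.2 hr), map_one, one_smul] at h5
  ext m
  obtain ⟨α, rfl⟩ := he' m
  rw [map_smul, h4, smul_zero, LinearMap.zero_apply]

variable {B : Type*} [Ring B] [Algebra k B] (ι : B →ₐ[k] A) {ε : B →ₐ[k] k} {V : Type*}
  [AddCommGroup V] [Module B V] (σ : V ≃+ k)

/-- The generator `1 ⊗ 1` of the module induced from a one-dimensional module. -/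
def ScalarExtension.generator : ScalarExtension (ι : B →+* A) V :=
  Submodule.Quotient.mk ((1 : A) ⊗ₜ[ℤ] σ.symm 1)

theorem ScalarExtension.smul_generator (α : A) :
    α • ScalarExtension.generator ι σ = Submodule.Quotient.mk (α ⊗ₜ[ℤ] σ.symm 1) := by
  rw [ScalarExtension.generator, ← Submodule.Quotient.mk_smul, TensorProduct.smul_tmul',
    smul_eq_mul, mul_one]

variable (hσ : ∀ b v, σ (b • v) = ε b * σ v)
include hσ

theorem ScalarExtension.mul_map_smul_generator (α : A) (β : B) :
    (α * ι β) • ScalarExtension.generator ι σ =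
      Submodule.Quotient.mk (α ⊗ₜ[ℤ] σ.symm (ε β)) := by
  have h : β • σ.symm 1 = σ.symm (ε β) := by
    rw [AddEquiv.eq_symm_apply, hσ, AddEquiv.apply_symm_apply, mul_one]
  rw [ScalarExtension.smul_generator, ← h]
  exact (Submodule.Quotient.eq _).2 (Submodule.subset_span ⟨α, β, _, rfl⟩)

theorem ScalarExtension.mk_tmul (α : A) (v : V) :
    (Submodule.Quotient.mk (α ⊗ₜ[ℤ] v) : ScalarExtension (ι : B →+* A) V) =
      (α * algebraMap k A (σ v)) • ScalarExtension.generator ι σ := by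
  rw [← AlgHom.commutes ι, ScalarExtension.mul_map_smul_generator ι σ hσ, AlgHom.commutes,
    Algebra.algebraMap_self, RingHom.id_apply, AddEquiv.symm_apply_apply]

theorem ScalarExtension.exists_eq_smul_generator (m : ScalarExtension (ι : B →+* A) V) :
    ∃ α : A, m = α • ScalarExtension.generator ι σ := by
  obtain ⟨z, rfl⟩ := Submodule.Quotient.mk_surjective _ m
  induction z using TensorProduct.induction_on with
  | zero => exact ⟨0, by rw [Submodule.Quotient.mk_zero, zero_smul]⟩
  | tmul α v => exact ⟨_, ScalarExtension.mk_tmul ι σ hσ α v⟩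
  | add x y hx hy =>
    obtain ⟨α, hα⟩ := hx
    obtain ⟨β, hβ⟩ := hy
    exact ⟨α + β, by rw [Submodule.Quotient.mk_add, hα, hβ, add_smul]⟩

theorem ScalarExtension.map_sub_algebraMap_smul_generator (β : B) :
    (ι β - algebraMap k A (ε β)) • ScalarExtension.generator ι σ = 0 := by
  have h := ScalarExtension.mul_map_smul_generator ι σ hσ 1 β
  rw [ScalarExtension.mk_tmul ι σ hσ, one_mul, one_mul, AddEquiv.apply_symm_apply] at h
  rw [sub_smul, h, sub_self]

/-- A functional equivariant under `B` descends to the induced module. -/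
theorem ScalarExtension.functional_eq_zero {Φ : A →ₗ[k] k}
    (hΦ : ∀ α β, Φ (α * ι β) = Φ α * ε β) {α : A}
    (hα : α • ScalarExtension.generator ι σ = 0) : Φ α = 0 := by
  let F : A ⊗[ℤ] V →ₗ[ℤ] k := TensorProduct.lift (((LinearMap.mul ℤ k).compl₂
    σ.toAddMonoidHom.toIntLinearMap).comp (Φ.restrictScalars ℤ))
  have hF : ∀ α v, F (α ⊗ₜ[ℤ] v) = Φ α * σ v := fun _ _ => rfl
  -- The relations form an `A`-span while `F` is only additive, so the induction must carry all left
  -- multiples.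
  have key : ∀ z ∈ balancedRelations (ι : B →+* A) V, ∀ γ : A, F (γ • z) = 0 := by
    intro z hz
    refine Submodule.span_induction (fun z hz γ => ?_) (fun γ => by rw [smul_zero, map_zero])
      (fun x y _ _ hx hy γ => by rw [smul_add, map_add, hx, hy, add_zero])
      (fun δ x _ hx γ => by rw [smul_smul]; exact hx _) hz
    obtain ⟨α, β, v, rfl⟩ := hz
    rw [smul_sub, map_sub, TensorProduct.smul_tmul', TensorProduct.smul_tmul', smul_eq_mul,
      smul_eq_mul, ← mul_assoc, hF, hF, hσ, RingHom.coe_coe, hΦ, mul_assoc, sub_self]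
  rw [ScalarExtension.smul_generator] at hα
  have h := key _ ((Submodule.Quotient.mk_eq_zero _).1 hα) 1
  rwa [one_smul, hF, AddEquiv.apply_symm_apply, mul_one] at h

end Cyclic

/-! ### Extending linear forms from `o` to `K` -/

section BaseChange

variable {R k X Y : Type*} [CommRing R] [Field k] [Algebra R k] [Ring X] [Algebra R X] [Ring Y]
  [Algebra R Y]

/-- The extension of scalars of a linear form. -/
def baseChangeForm (J : X →ₗ[R] R) : k ⊗[R] X →ₗ[k] k :=
  TensorProduct.AlgebraTensorModule.lift
    ((LinearMap.lsmul k (X →ₗ[R] k)).flip ((Algebra.linearMap R k).comp J))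

theorem baseChangeForm_tmul (J : X →ₗ[R] R) (c : k) (x : X) :
    baseChangeForm J (c ⊗ₜ[R] x) = c * algebraMap R k (J x) := rfl

theorem baseChangeForm_mul_map {J : X →ₗ[R] R} {J' : Y →ₗ[R] R} {μ : Y →ₐ[R] X}
    (hJ : ∀ x y, J (x * μ y) = J x * J' y) {ε : k ⊗[R] Y →ₐ[k] k}
    (hε : ∀ y, ε (1 ⊗ₜ y) = algebraMap R k (J' y)) (α : k ⊗[R] X) (β : k ⊗[R] Y) :
    baseChangeForm J (α * Algebra.TensorProduct.map (AlgHom.id k k) μ β) =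
      baseChangeForm J α * ε β := by
  induction β using TensorProduct.induction_on with
  | zero => simp
  | add β β' h h' => rw [map_add, map_add, mul_add, mul_add, map_add, h, h']
  | tmul d y =>
    have hd : ε (d ⊗ₜ[R] y) = d * algebraMap R k (J' y) := by
      rw [← hε, ← smul_eq_mul, ← map_smul, TensorProduct.smul_tmul', smul_eq_mul, mul_one]
    rw [hd]
    induction α using TensorProduct.induction_on with
    | zero => simp
    | add α α' h h' => rw [add_mul, map_add, map_add, add_mul, h, h']
    | tmul c x =>
      rw [Algebra.TensorProduct.map_tmul, Algebra.TensorProduct.tmul_mul_tmul,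
        baseChangeForm_tmul, baseChangeForm_tmul, hJ, map_mul, AlgHom.id_apply]
      ring

end BaseChange

/-! ### The modules `M_χ` over `K[[G]]` -/

section Modules

variable {p : ℕ} [Fact p.Prime] {K : Type*} [NormedField K] [NormedAlgebra ℚ_[p] K]

section Iwasawa

variable {G : Type*} [Group G] [TopologicalSpace G]

/-- The canonical map `o[[G]] → K[[G]]`. -/
def toIwasawa : CompletedGroupAlgebra (padicIntegers p K) G →ₐ[padicIntegers p K]
    IwasawaAlgebra p K G :=
  Algebra.TensorProduct.includeRight

theorem smul_toIwasawa (c : K) (a : CompletedGroupAlgebra (padicIntegers p K) G) :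
    c • (toIwasawa a : IwasawaAlgebra p K G) = c ⊗ₜ[padicIntegers p K] a := by
  change c • ((1 : K) ⊗ₜ[padicIntegers p K] a) = _
  rw [TensorProduct.smul_tmul', smul_eq_mul, mul_one]

theorem coe_smul_toIwasawa (r : padicIntegers p K)
    (a : CompletedGroupAlgebra (padicIntegers p K) G) :
    (toIwasawa (r • a) : IwasawaAlgebra p K G) = (r : K) • toIwasawa a := by
  rw [map_smul]
  exact algebra_compatible_smul K r _

theorem toIwasawa_mul (a b : CompletedGroupAlgebra (padicIntegers p K) G) :
    (toIwasawa (a * b) : IwasawaAlgebra p K G) = toIwasawa a * toIwasawa b :=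
  map_mul toIwasawa a b

theorem toIwasawa_add (a b : CompletedGroupAlgebra (padicIntegers p K) G) :
    (toIwasawa (a + b) : IwasawaAlgebra p K G) = toIwasawa a + toIwasawa b :=
  map_add toIwasawa a b

theorem toIwasawa_one :
    (toIwasawa (1 : CompletedGroupAlgebra (padicIntegers p K) G) : IwasawaAlgebra p K G) = 1 :=
  rfl

theorem smul_toIwasawa_smul_one_add_sub (c : K) (r : padicIntegers p K)
    (a : CompletedGroupAlgebra (padicIntegers p K) G) :
    c • (toIwasawa (r • 1 + a) : IwasawaAlgebra p K G) -
        algebraMap K (IwasawaAlgebra p K G) (c * r) =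
      algebraMap K (IwasawaAlgebra p K G) c • (toIwasawa a : IwasawaAlgebra p K G) := by
  rw [toIwasawa_add, coe_smul_toIwasawa, toIwasawa_one]
  exact smul_smul_one_add_sub_algebraMap (A := IwasawaAlgebra p K G) c (r : K) (toIwasawa a)

theorem toIwasawa_sub_algebraMap (a : CompletedGroupAlgebra (padicIntegers p K) G)
    (r : padicIntegers p K) :
    (toIwasawa (a - algebraMap _ _ r) : IwasawaAlgebra p K G) =
      toIwasawa a - algebraMap K _ (r : K) := by
  rw [map_sub, AlgHom.commutes]
  rfl

/-- Common denominators: in `c • a + d • b` the scalar of larger norm is factored out and the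
quotient is integral. -/
theorem exists_smul_toIwasawa (α : IwasawaAlgebra p K G) :
    ∃ (c : K) (a : CompletedGroupAlgebra (padicIntegers p K) G), α = c • toIwasawa a := by
  have key : ∀ (c d : K) (a b : CompletedGroupAlgebra (padicIntegers p K) G), ‖d‖ ≤ ‖c‖ →
      ∃ (c' : K) (a' : CompletedGroupAlgebra (padicIntegers p K) G),
        c • (toIwasawa a : IwasawaAlgebra p K G) + d • toIwasawa b = c' • toIwasawa a' := by
    intro c d a b h
    by_cases hc : c = 0
    · exact ⟨d, b, by simp [hc]⟩
    · let r : padicIntegers p K := ⟨d / c, by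
        change ‖d / c‖ ≤ 1
        rw [norm_div]
        exact div_le_one_of_le₀ h (norm_nonneg _)⟩
      have hr : c * (r : K) = d := mul_div_cancel₀ d hc
      refine ⟨c, a + r • b, ?_⟩
      rw [map_add, coe_smul_toIwasawa, smul_add, smul_smul, hr]
  induction α using TensorProduct.induction_on with
  | zero => exact ⟨0, 0, by simp⟩
  | tmul c a => exact ⟨c, a, (smul_toIwasawa c a).symm⟩
  | add α β hα hβ =>
    obtain ⟨c, a, rfl⟩ := hα
    obtain ⟨d, b, rfl⟩ := hβ
    rcases le_total ‖d‖ ‖c‖ with h | h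
    · exact key c d a b h
    · rw [add_comm]
      exact key d c b a h

theorem map_toIwasawa {G' : Type*} [Group G'] [TopologicalSpace G'] (f : G →ₜ* G')
    (a : CompletedGroupAlgebra (padicIntegers p K) G) :
    IwasawaAlgebra.map p K f (toIwasawa a) =
      toIwasawa (CompletedGroupAlgebra.map (padicIntegers p K) f a) := by
  exact (Algebra.TensorProduct.map_tmul _ _ _ _).trans (by simp [toIwasawa])

end Iwasawa

variable [FiniteDimensional ℚ_[p] K]

instance : CompactSpace (padicIntegers p K) := by
  have : ProperSpace K := FiniteDimensional.proper ℚ_[p] K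
  have h : ((padicIntegers p K : Subring K) : Set K) = Metric.closedBall 0 1 := by
    ext x
    exact mem_closedBall_zero_iff.symm
  have hc : IsCompact ((padicIntegers p K : Subring K) : Set K) := by
    rw [h]
    exact isCompact_closedBall _ _
  exact isCompact_iff_compactSpace.1 hc

omit [FiniteDimensional ℚ_[p] K] in
variable (p K) in
theorem isOpen_pIdeal_pow (n : ℕ) :
    IsOpen ((pIdeal p K ^ n : Ideal (padicIntegers p K)) : Set (padicIntegers p K)) :=
  (isAdic_iff.mp (isAdic_pIdeal p K)).1 n

section IwasawaIntegral

variable {G : Type*} [Group G] [TopologicalSpace G] [IsTopologicalGroup G] [CompactSpace G]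
  [TotallyDisconnectedSpace G]

/-- The `K`-linear extension of the integral to `K[[G]]`. -/
def iwasawaIntegral (φ : C(G, padicIntegers p K)) : IwasawaAlgebra p K G →ₗ[K] K :=
  baseChangeForm (integral (pIdeal p K) (isOpen_pIdeal_pow p K) φ)

theorem iwasawaIntegral_toIwasawa (φ : C(G, padicIntegers p K))
    (a : CompletedGroupAlgebra (padicIntegers p K) G) :
    iwasawaIntegral φ (toIwasawa a) = integral (pIdeal p K) (isOpen_pIdeal_pow p K) φ a :=
  one_mul _

variable {G' : Type*} [Group G'] [TopologicalSpace G'] [IsTopologicalGroup G'] [CompactSpace G']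
  [TotallyDisconnectedSpace G']

theorem character_toIwasawa (χ : G' →ₜ* (padicIntegers p K)ˣ)
    (a : CompletedGroupAlgebra (padicIntegers p K) G') :
    IwasawaAlgebra.character χ (toIwasawa a) =
      integral (pIdeal p K) (isOpen_pIdeal_pow p K) (characterFun χ) a := by
  refine (one_mul _).trans ?_
  exact congrArg (algebraMap (padicIntegers p K) K) (characterExt_eq_integral (pIdeal p K) (isOpen_pIdeal_pow p K) χ a)

end IwasawaIntegral

/-- The character of `P` obtained from a character of `T`. -/
def inflation (χ : diagonalTorus p →ₜ* (padicIntegers p K)ˣ) :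
    lowerTriangular p →ₜ* (padicIntegers p K)ˣ :=
  χ.comp (torusProjection p)

instance : CompactSpace (diagonalTorus p) := by
  have h : IsClosed (diagonalTorus p : Set (GL (Fin 2) ℤ_[p])) :=
    (isClosed_eq (continuous_GL_entry p 0 1) continuous_const).inter
      (isClosed_eq (continuous_GL_entry p 1 0) continuous_const)
  exact isCompact_iff_compactSpace.1 h.isCompact

variable {χ : diagonalTorus p →ₜ* (padicIntegers p K)ˣ}

theorem character_map_toIwasawa (β : CompletedGroupAlgebra (padicIntegers p K) (lowerTriangular p)) :
    IwasawaAlgebra.character χ (IwasawaAlgebra.map p K (torusProjection p) (toIwasawa β)) =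
      integral (pIdeal p K) (isOpen_pIdeal_pow p K) (characterFun (inflation χ)) β := by
  rw [map_toIwasawa, character_toIwasawa, integral_map]
  rfl

/-- The character of `K[[P]]` through which it acts on `K^(χ)`. -/
def iwasawaCharacter (χ : diagonalTorus p →ₜ* (padicIntegers p K)ˣ) :
    IwasawaAlgebra p K (lowerTriangular p) →ₐ[K] K :=
  (IwasawaAlgebra.character χ).comp (IwasawaAlgebra.map p K (torusProjection p))

theorem iwasawaCharacter_toIwasawa
    (β : CompletedGroupAlgebra (padicIntegers p K) (lowerTriangular p)) :
    iwasawaCharacter χ (toIwasawa β) =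
      integral (pIdeal p K) (isOpen_pIdeal_pow p K) (characterFun (inflation χ)) β :=
  character_map_toIwasawa β

theorem iwasawaIntegral_mul_map {φ : C(GL (Fin 2) ℤ_[p], padicIntegers p K)}
    (hφ : ∀ x (b : lowerTriangular p), φ (x * b.1) = φ x * inflation χ b)
    (α : IwasawaAlgebra p K (GL (Fin 2) ℤ_[p])) (β : IwasawaAlgebra p K (lowerTriangular p)) :
    iwasawaIntegral φ (α * IwasawaAlgebra.map p K (lowerTriangularInclusion p) β) =
      iwasawaIntegral φ α * iwasawaCharacter χ β :=
  baseChangeForm_mul_map (integral_mul_map (pIdeal p K) (isOpen_pIdeal_pow p K)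
    (lowerTriangularInclusion p) (inflation χ) φ hφ) iwasawaCharacter_toIwasawa α β

omit [FiniteDimensional ℚ_[p] K] in
theorem torusProjection_lowerUnipotent (z : ℤ_[p]) :
    torusProjection p ⟨lowerUnipotent p z, lowerUnipotent_mem p z⟩ = 1 := by
  refine Subtype.ext (Units.ext ?_)
  change !![(1 : ℤ_[p]), 0; 0, 1] = 1
  exact Matrix.one_fin_two.symm

-- The source of the `N`-invariance: on `N` the relation `[n] - χ(n)` is `[n] - 1`.
omit [FiniteDimensional ℚ_[p] K] in
theorem inflation_lowerUnipotent (z : ℤ_[p]) :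
    inflation χ ⟨lowerUnipotent p z, lowerUnipotent_mem p z⟩ = 1 :=
  (congrArg χ (torusProjection_lowerUnipotent z)).trans (map_one χ)

omit [FiniteDimensional ℚ_[p] K] in
theorem toIwasawa_mem_of_mem_span {𝔞 : Submodule (IwasawaAlgebra p K (GL (Fin 2) ℤ_[p]))
      (IwasawaAlgebra p K (GL (Fin 2) ℤ_[p]))} {ι : Type*}
    {d : ι → CompletedGroupAlgebra (padicIntegers p K) (GL (Fin 2) ℤ_[p])}
    (hd : ∀ i, toIwasawa (d i) ∈ 𝔞)
    {x : CompletedGroupAlgebra (padicIntegers p K) (GL (Fin 2) ℤ_[p])}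
    (hx : x ∈ Submodule.span (CompletedGroupAlgebra (padicIntegers p K) (GL (Fin 2) ℤ_[p]))
      (Set.range d)) : toIwasawa x ∈ 𝔞 := by
  induction hx using Submodule.span_induction with
  | mem x hx =>
    obtain ⟨i, rfl⟩ := hx
    exact hd i
  | zero => rw [map_zero]; exact 𝔞.zero_mem
  | add x y _ _ hx hy => rw [toIwasawa_add]; exact 𝔞.add_mem hx hy
  | smul a x _ hx =>
    rw [smul_eq_mul, toIwasawa_mul]
    exact 𝔞.smul_mem _ hx

theorem integral_leftTranslate_eq {χ' : diagonalTorus p →ₜ* (padicIntegers p K)ˣ}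
    {φ : C(GL (Fin 2) ℤ_[p], padicIntegers p K)} {z : ℤ_[p]}
    {a : CompletedGroupAlgebra (padicIntegers p K) (GL (Fin 2) ℤ_[p])}
    (h : integral (pIdeal p K) (isOpen_pIdeal_pow p K) φ
      (characterRelation (lowerTriangularInclusion p) (inflation χ')
        ⟨lowerUnipotent p z, lowerUnipotent_mem p z⟩ * a) = 0) :
    integral (pIdeal p K) (isOpen_pIdeal_pow p K) (leftTranslate (lowerUnipotent p z) φ) a =
      integral (pIdeal p K) (isOpen_pIdeal_pow p K) φ a := by
  rw [characterRelation, inflation_lowerUnipotent, Units.val_one, map_one, sub_mul, one_mul,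
    map_sub, sub_eq_zero] at h
  rw [← h]
  exact (integral_of_mul _ _ φ _ a).symm

/-- Let `𝔞` be a left ideal of `K[[G]]` containing the relations of `M_χ` and killed by the
integrals of equivariant functions. An element of `K[[G]]` on which `P` acts, modulo `𝔞`, through
a character of `T` is a scalar modulo `𝔞`. -/
theorem exists_sub_algebraMap_mem {χ' : diagonalTorus p →ₜ* (padicIntegers p K)ˣ}
    {𝔞 : Submodule (IwasawaAlgebra p K (GL (Fin 2) ℤ_[p]))
      (IwasawaAlgebra p K (GL (Fin 2) ℤ_[p]))}
    (hrel : ∀ b, toIwasawa (characterRelation (lowerTriangularInclusion p) (inflation χ) b) ∈ 𝔞)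
    (hint : ∀ (φ : C(GL (Fin 2) ℤ_[p], padicIntegers p K)),
      (∀ x (b : lowerTriangular p), φ (x * b.1) = φ x * inflation χ b) →
      ∀ α ∈ 𝔞, iwasawaIntegral φ α = 0)
    {α : IwasawaAlgebra p K (GL (Fin 2) ℤ_[p])}
    (hα : ∀ b, toIwasawa (characterRelation (lowerTriangularInclusion p) (inflation χ') b) * α ∈ 𝔞) :
    ∃ c : K, α - algebraMap K _ c ∈ 𝔞 := by
  obtain ⟨c, a, rfl⟩ := exists_smul_toIwasawa α
  -- For `c = 0` nothing is known about `a`; otherwise `c` can be cancelled from the vanishing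
  -- integrals.
  by_cases hc : c = 0
  · refine ⟨0, ?_⟩
    rw [hc, zero_smul, map_zero, sub_zero]
    exact 𝔞.zero_mem
  have hinv : ∀ (φ : C(GL (Fin 2) ℤ_[p], padicIntegers p K)),
      (∀ x (b : lowerTriangular p), φ (x * b.1) = φ x * inflation χ b) → ∀ z,
        integral (pIdeal p K) (isOpen_pIdeal_pow p K) (leftTranslate (lowerUnipotent p z) φ) a =
          integral (pIdeal p K) (isOpen_pIdeal_pow p K) φ a := by
    intro φ hφ z
    have h := hα ⟨lowerUnipotent p z, lowerUnipotent_mem p z⟩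
    rw [mul_smul_comm, ← toIwasawa_mul] at h
    have h1 := hint φ hφ _ h
    rw [map_smul (iwasawaIntegral φ), iwasawaIntegral_toIwasawa, smul_eq_mul, mul_eq_zero,
      or_iff_right hc] at h1
    exact integral_leftTranslate_eq (Subtype.ext h1)
  obtain ⟨S, hS⟩ := exists_finset_dense_lowerTriangular p
  have ha := mem_scalarsSupLeftSpan_of_integral_eq_zero (pIdeal p K) (isAdic_pIdeal p K) S hS a
    fun g hg k => integral_orbitFun_eq_zero (pIdeal p K) (isOpen_pIdeal_pow p K)
      (Ideal.mem_span_singleton_self _) a hinv hg k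
  -- Now `a = r • 1 + j` with `j` in the left ideal of relations, so `α` is the scalar `c * r`
  -- modulo `𝔞`.
  obtain ⟨y, hy, j, hj, rfl⟩ := Submodule.mem_sup.1 ha
  obtain ⟨r, rfl⟩ := Submodule.mem_span_singleton.1 hy
  have hj' := toIwasawa_mem_of_mem_span (fun s : S => hrel s.1) hj
  refine ⟨c * r, ?_⟩
  rw [smul_toIwasawa_smul_one_add_sub]
  exact 𝔞.smul_mem _ hj'

/-- The canonical generator `1 ⊗ 1` of `M_χ`. -/
def principalSeriesGenerator (χ : diagonalTorus p →ₜ* (padicIntegers p K)ˣ) :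
    PrincipalSeriesModule χ :=
  ScalarExtension.generator (k := K) (V := TorusCharModule χ)
    (IwasawaAlgebra.map p K (lowerTriangularInclusion p)) (AddEquiv.refl K)

theorem torusCharModule_smul (b : IwasawaAlgebra p K (lowerTriangular p)) (v : TorusCharModule χ) :
    (AddEquiv.refl K : TorusCharModule χ ≃+ K) (b • v) =
      iwasawaCharacter χ b * (AddEquiv.refl K : TorusCharModule χ ≃+ K) v := rfl

theorem exists_eq_smul_principalSeriesGenerator (m : PrincipalSeriesModule χ) :
    ∃ α : IwasawaAlgebra p K (GL (Fin 2) ℤ_[p]), m = α • principalSeriesGenerator χ :=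
  ScalarExtension.exists_eq_smul_generator _ _ (torusCharModule_smul (χ := χ)) m

theorem map_sub_algebraMap_smul_principalSeriesGenerator
    (β : IwasawaAlgebra p K (lowerTriangular p)) :
    (IwasawaAlgebra.map p K (lowerTriangularInclusion p) β -
      algebraMap K _ (iwasawaCharacter χ β)) • principalSeriesGenerator χ = 0 :=
  ScalarExtension.map_sub_algebraMap_smul_generator _ _ (torusCharModule_smul (χ := χ)) β

theorem map_of_sub_algebraMap (b : lowerTriangular p) :
    IwasawaAlgebra.map p K (lowerTriangularInclusion p)
        (toIwasawa (CompletedGroupAlgebra.of (padicIntegers p K) b)) -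
      algebraMap K _ (iwasawaCharacter χ (toIwasawa (CompletedGroupAlgebra.of _ b))) =
    toIwasawa (characterRelation (lowerTriangularInclusion p) (inflation χ) b) := by
  rw [iwasawaCharacter_toIwasawa, integral_of, map_toIwasawa, CompletedGroupAlgebra.map_of,
    characterRelation, toIwasawa_sub_algebraMap]
  rfl

theorem characterRelation_smul_generator (b : lowerTriangular p) :
    (toIwasawa (characterRelation (lowerTriangularInclusion p) (inflation χ) b) :
      IwasawaAlgebra p K (GL (Fin 2) ℤ_[p])) • principalSeriesGenerator χ = 0 := by
  rw [← map_of_sub_algebraMap]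
  exact map_sub_algebraMap_smul_principalSeriesGenerator _

theorem iwasawaIntegral_eq_zero {φ : C(GL (Fin 2) ℤ_[p], padicIntegers p K)}
    (hφ : ∀ x (b : lowerTriangular p), φ (x * b.1) = φ x * inflation χ b)
    {α : IwasawaAlgebra p K (GL (Fin 2) ℤ_[p])} (hα : α • principalSeriesGenerator χ = 0) :
    iwasawaIntegral φ α = 0 :=
  ScalarExtension.functional_eq_zero _ _ (torusCharModule_smul (χ := χ)) (iwasawaIntegral_mul_map hφ) hα

/-- The Weyl element `w` lies off `P`, and the equivariant function on its orbit has value `1` at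
`w`. The functional it defines is nonzero on `[w]`, so `[w]` does not kill the generator. -/
theorem principalSeriesGenerator_ne_zero : principalSeriesGenerator χ ≠ 0 := by
  intro h
  let w : GL (Fin 2) ℤ_[p] := ⟨!![0, 1; 1, 0], !![0, 1; 1, 0], by simp [Matrix.one_fin_two],
    by simp [Matrix.one_fin_two]⟩
  have hw : w 0 1 ≠ 0 := one_ne_zero
  have h1 := iwasawaIntegral_eq_zero (χ := χ) (φ := orbitFun (inflation χ) hw 0)
    (orbitFun_mul hw 0) (α := toIwasawa (CompletedGroupAlgebra.of _ w)) (by rw [h, smul_zero])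
  rw [iwasawaIntegral_toIwasawa, integral_of] at h1
  have h2 := orbitFun_apply (ψ := inflation χ) hw 0 0 1
  rw [if_pos (dvd_zero _), lowerUnipotent_zero, one_mul, Subgroup.coe_one, mul_one, map_one] at h2
  rw [h2] at h1
  exact one_ne_zero h1

omit [FiniteDimensional ℚ_[p] K] in
theorem torusProjection_coe (t : diagonalTorus p) : torusProjection p ⟨t.1, t.2.1⟩ = t := by
  refine Subtype.ext (Units.ext ?_)
  change !![t.1 0 0, 0; 0, t.1 1 1] = t.1.1
  have h0 : t.1.1 0 1 = 0 := t.2.1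
  have h1 : t.1.1 1 0 = 0 := t.2.2
  rw [Matrix.eta_fin_two t.1.1, h0, h1]
  rfl

theorem iwasawaCharacter_of (t : diagonalTorus p) :
    iwasawaCharacter χ (toIwasawa (CompletedGroupAlgebra.of _ ⟨t.1, t.2.1⟩)) =
      ((χ t : padicIntegers p K) : K) := by
  rw [iwasawaCharacter_toIwasawa, integral_of]
  exact congrArg (fun t => ((χ t : padicIntegers p K) : K)) (torusProjection_coe t)

theorem characterRelation_mem_ker (b : lowerTriangular p) :
    (toIwasawa (characterRelation (lowerTriangularInclusion p) (inflation χ) b) :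
      IwasawaAlgebra p K (GL (Fin 2) ℤ_[p])) ∈ LinearMap.ker (LinearMap.toSpanSingleton
        (IwasawaAlgebra p K (GL (Fin 2) ℤ_[p])) (PrincipalSeriesModule χ)
        (principalSeriesGenerator χ)) :=
  characterRelation_smul_generator b

theorem iwasawaIntegral_eq_zero_of_mem_ker {φ : C(GL (Fin 2) ℤ_[p], padicIntegers p K)}
    (hφ : ∀ x (b : lowerTriangular p), φ (x * b.1) = φ x * inflation χ b)
    (α : IwasawaAlgebra p K (GL (Fin 2) ℤ_[p])) (hα : α ∈ LinearMap.ker (LinearMap.toSpanSingleton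
        (IwasawaAlgebra p K (GL (Fin 2) ℤ_[p])) (PrincipalSeriesModule χ)
        (principalSeriesGenerator χ))) :
    iwasawaIntegral φ α = 0 :=
  iwasawaIntegral_eq_zero (χ := χ) hφ hα

/-- The left ideal `𝔞` is taken to be the annihilator of the generator of `M_χ`. -/
theorem exists_sub_algebraMap_mem_ker {χ' : diagonalTorus p →ₜ* (padicIntegers p K)ˣ}
    {α : IwasawaAlgebra p K (GL (Fin 2) ℤ_[p])}
    (h : ∀ b, toIwasawa (characterRelation (lowerTriangularInclusion p) (inflation χ') b) * α ∈
      LinearMap.ker (LinearMap.toSpanSingleton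
        (IwasawaAlgebra p K (GL (Fin 2) ℤ_[p])) (PrincipalSeriesModule χ)
        (principalSeriesGenerator χ))) :
    ∃ c : K, α - algebraMap K _ c ∈ LinearMap.ker (LinearMap.toSpanSingleton
        (IwasawaAlgebra p K (GL (Fin 2) ℤ_[p])) (PrincipalSeriesModule χ)
        (principalSeriesGenerator χ)) :=
  exists_sub_algebraMap_mem (χ := χ) (χ' := χ') (α := α)
    (𝔞 := LinearMap.ker (LinearMap.toSpanSingleton
        (IwasawaAlgebra p K (GL (Fin 2) ℤ_[p])) (PrincipalSeriesModule χ)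
        (principalSeriesGenerator χ)))
    characterRelation_mem_ker (fun _ hφ => iwasawaIntegral_eq_zero_of_mem_ker (χ := χ) hφ) h

theorem characterRelation_mul_mem_ker {χ' : diagonalTorus p →ₜ* (padicIntegers p K)ˣ}
    (f : PrincipalSeriesModule χ' →ₗ[IwasawaAlgebra p K (GL (Fin 2) ℤ_[p])]
      PrincipalSeriesModule χ) {α : IwasawaAlgebra p K (GL (Fin 2) ℤ_[p])}
    (hα : f (principalSeriesGenerator χ') = α • principalSeriesGenerator χ)
    (b : lowerTriangular p) :
    toIwasawa (characterRelation (lowerTriangularInclusion p) (inflation χ') b) * α ∈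
      LinearMap.ker (LinearMap.toSpanSingleton
        (IwasawaAlgebra p K (GL (Fin 2) ℤ_[p])) (PrincipalSeriesModule χ)
        (principalSeriesGenerator χ)) :=
  mul_mem_ker_toSpanSingleton f hα (characterRelation_smul_generator (χ := χ') b)

theorem exists_smul_generator_eq {α : IwasawaAlgebra p K (GL (Fin 2) ℤ_[p])}
    (h : ∃ c : K, α - algebraMap K _ c ∈ LinearMap.ker (LinearMap.toSpanSingleton
        (IwasawaAlgebra p K (GL (Fin 2) ℤ_[p])) (PrincipalSeriesModule χ)
        (principalSeriesGenerator χ))) :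
    ∃ c : K, α • principalSeriesGenerator χ  =
      algebraMap K (IwasawaAlgebra p K (GL (Fin 2) ℤ_[p])) c • principalSeriesGenerator χ := by
  obtain ⟨c, hc⟩ := h
  exact ⟨c, smul_eq_smul_of_sub_mem_ker hc⟩

theorem exists_map_generator_eq_of_eq_smul {χ' : diagonalTorus p →ₜ* (padicIntegers p K)ˣ}
    (f : PrincipalSeriesModule χ' →ₗ[IwasawaAlgebra p K (GL (Fin 2) ℤ_[p])]
      PrincipalSeriesModule χ) {α : IwasawaAlgebra p K (GL (Fin 2) ℤ_[p])}
    (hα : f (principalSeriesGenerator χ') = α • principalSeriesGenerator χ) :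
    ∃ c : K, f (principalSeriesGenerator χ') =
      algebraMap K (IwasawaAlgebra p K (GL (Fin 2) ℤ_[p])) c • principalSeriesGenerator χ := by
  rw [hα]
  exact exists_smul_generator_eq (exists_sub_algebraMap_mem_ker (χ := χ) (χ' := χ')
      (characterRelation_mul_mem_ker f hα))
theorem exists_map_generator_eq {χ' : diagonalTorus p →ₜ* (padicIntegers p K)ˣ}
    (f : PrincipalSeriesModule χ' →ₗ[IwasawaAlgebra p K (GL (Fin 2) ℤ_[p])]
      PrincipalSeriesModule χ) :
    ∃ c : K, f (principalSeriesGenerator χ') =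
      algebraMap K (IwasawaAlgebra p K (GL (Fin 2) ℤ_[p])) c • principalSeriesGenerator χ := by
  have h := exists_eq_smul_principalSeriesGenerator (χ := χ) (f (principalSeriesGenerator χ'))
  exact h.elim fun α hα => exists_map_generator_eq_of_eq_smul f hα

theorem hom_eq_zero {χ' : diagonalTorus p →ₜ* (padicIntegers p K)ˣ} (hχ : χ ≠ χ')
    (f : PrincipalSeriesModule χ' →ₗ[IwasawaAlgebra p K (GL (Fin 2) ℤ_[p])]
      PrincipalSeriesModule χ) : f = 0 := by
  have hne : ∃ t, χ t ≠ χ' t := by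
    by_contra! h
    exact hχ (ContinuousMonoidHom.ext h)
  refine hne.elim fun t ht => ?_
  -- The element `[t]`, with `t` viewed in `P`, is the operator with distinct eigenvalues `χ t` and
  -- `χ' t` on the two generators.
  have hr : iwasawaCharacter χ (toIwasawa (CompletedGroupAlgebra.of _ ⟨t.1, t.2.1⟩)) ≠
      iwasawaCharacter χ' (toIwasawa (CompletedGroupAlgebra.of _ ⟨t.1, t.2.1⟩)) := by
    rw [iwasawaCharacter_of, iwasawaCharacter_of]
    exact fun h => ht (Units.ext (Subtype.ext h))
  have h1 := map_sub_algebraMap_smul_principalSeriesGenerator (χ := χ)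
    (toIwasawa (CompletedGroupAlgebra.of _ ⟨t.1, t.2.1⟩))
  have h2 := map_sub_algebraMap_smul_principalSeriesGenerator (χ := χ')
    (toIwasawa (CompletedGroupAlgebra.of _ ⟨t.1, t.2.1⟩))
  exact hom_eq_zero_of_eigenvalue_ne (k := K) (A := IwasawaAlgebra p K (GL (Fin 2) ℤ_[p]))
    (M := PrincipalSeriesModule χ) (M' := PrincipalSeriesModule χ')
    (e := principalSeriesGenerator χ) (e' := principalSeriesGenerator χ')
    (exists_eq_smul_principalSeriesGenerator (χ := χ')) hr
    h1 h2 f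
    (exists_map_generator_eq f)

end Modules

end

theorem proposition4p5 (p : ℕ) [Fact p.Prime] (K : Type*) [NormedField K] [NormedAlgebra ℚ_[p] K]
    [FiniteDimensional ℚ_[p] K] (χ χ' : diagonalTorus p →ₜ* (padicIntegers p K)ˣ) (hχ : χ ≠ χ') :
    (∀ f : PrincipalSeriesModule χ' →ₗ[IwasawaAlgebra p K (GL (Fin 2) ℤ_[p])]
      PrincipalSeriesModule χ, f = 0) ∧
    IsEmpty (PrincipalSeriesModule χ ≃ₗ[IwasawaAlgebra p K (GL (Fin 2) ℤ_[p])]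
      PrincipalSeriesModule χ') := by
  refine ⟨hom_eq_zero hχ, ⟨fun e => principalSeriesGenerator_ne_zero (χ := χ) ?_⟩⟩
  -- The inverse of an isomorphism is a map `M_χ' → M_χ`, hence zero, and would send the image of
  -- the generator back to it.
  have h := LinearMap.congr_fun (hom_eq_zero hχ e.symm.toLinearMap) (e (principalSeriesGenerator χ))
  simpa using h
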